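/- Let $k\ge 1$ and $1\le h\le k$ be integers. A noncrossing tree with $n$ vertices is a tree on vertices $v_1,\dots,v_n$, placed in this order on a circle, whose edges, drawn as chords, do not intersect at interior points; its root is $v_1$. A $k$-noncrossing tree is a noncrossing tree whose vertices are labelled with labels in $\{1,\dots,k\}$ in such a way that, for any two adjacent vertices $v_i,v_j$ with $i<j$ such that the path from the root $v_1$ to $v_j$ contains $v_i$, the labels of $v_i$ and $v_j$ have sum at most $k+1$. Write $m^{\overline{k}}=m(m+1)\cdots(m+k-1)$ for the rising factorial. For every $n>1$, the set of $k$-noncrossing trees with $n$ vertices is nonempty, and the average number of vertices labelled $h$ in $k$-noncrossing trees with $n$ vertices is $$\frac{n}{(2k+1)n-(k+1)} \left( 3n-2 - \frac{2(h-1)(n-1)}{k} + \frac{2(k+1-2h)}{(2k+1)\left(2 - \frac{(2kn+n-2k)^{\overline{k}}}{(2kn+1-2k)^{\overline{k}}}\right)} \right),$$ where all denominators are nonzero. As $n\to\infty$ with $k$ and $h$ fixed, this average is equal to $$\frac{3k+2-2h}{k(2k+1)}\, n + \frac{k+1-2h}{(2k+1)^2\left(2\left(\frac{2k}{2k+1}\right)^{k}-1\right)}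 + O(1/n),$$ where again the denominators are nonzero. -/

import Mathlib

open Filter Asymptotics
open scoped Classical

/-- `G` is a noncrossing tree on the points `v₁, …, vₙ`, placed in this order on a circle
(`vᵢ` is the element `i - 1` of `Fin n`): it is a tree, and no two of its edges, drawn as chords,
cross. Two chords cross at an interior point exactly when their endpoints alternate. -/
def IsNoncrossingTree {n : ℕ} (G : SimpleGraph (Fin n)) : Prop :=
  G.IsTree ∧ ∀ a b c d : Fin n, a < b → b < c → c < d → ¬ (G.Adj a c ∧ G.Adj b d)

/-- The path in `G` from the root `v₁` (the vertex with index `0`) to `j` contains `i`.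
(In a tree there is exactly one such path.) -/
def OnRootPath {n : ℕ} (G : SimpleGraph (Fin n)) (i j : Fin n) : Prop :=
  ∃ (r : Fin n) (p : G.Walk r j), (r : ℕ) = 0 ∧ p.IsPath ∧ i ∈ p.support

/-- `G` with the vertex labels `lab` in `{1, …, k}` is a `k`-noncrossing tree: `G` is a
noncrossing tree, and the labels of adjacent vertices `vᵢ`, `vⱼ` with `i < j` have sum at most
`k + 1` whenever the path from the root to `vⱼ` contains `vᵢ`. -/
def IsKNoncrossingTree (k : ℕ) {n : ℕ} (G : SimpleGraph (Fin n))
    (lab : Fin n → Finset.Icc 1 k) : Prop :=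
  IsNoncrossingTree G ∧
    ∀ i j : Fin n, i < j → G.Adj i j → OnRootPath G i j →
      (lab i : ℕ) + (lab j : ℕ) ≤ k + 1

/-- The finite set of all `k`-noncrossing trees with `n` vertices. -/
noncomputable def kNoncrossingTrees (k n : ℕ) :
    Finset (SimpleGraph (Fin n) × (Fin n → Finset.Icc 1 k)) :=
  Finset.univ.filter fun T => IsKNoncrossingTree k T.1 T.2

/-- The number of vertices with label `h`. -/
noncomputable def labelCount {k n : ℕ} (h : ℕ)
    (T : SimpleGraph (Fin n) × (Fin n → Finset.Icc 1 k)) : ℕ :=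
  (Finset.univ.filter fun v : Fin n => (T.2 v : ℕ) = h).card

/-- The average number of vertices labelled `h` in `k`-noncrossing trees with `n` vertices. -/
noncomputable def averageLabelCount (k n h : ℕ) : ℝ :=
  (∑ T ∈ kNoncrossingTrees k n, (labelCount h T : ℝ)) / ((kNoncrossingTrees k n).card : ℝ)

/-- The rising factorial `m (m + 1) ⋯ (m + k - 1)`. -/
noncomputable def risingFactorial (m : ℝ) (k : ℕ) : ℝ :=
  ∏ i ∈ Finset.range k, (m + (i : ℝ))

/-!
A tree is transported to `ℤ`, where its vertices form an interval `[0, n]` with the root at `0`.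
Let `c` be the largest neighbour of the root. Removing the edge from `0` to `c` leaves two
components; since edges do not cross, they are intervals `[0, n₁]` and `[n₁ + 1, n]`, and `c` splits
the second one into a tree on `[n₁ + 1, c]`, whose root is its last vertex, and a tree on `[c, n]`,
whose root is its first vertex (`IsLabelledTree.exists_split`). Reflecting the middle tree turns it
into a tree rooted at its first vertex, but exchanges edges that lead upwards with edges that lead
downwards; the sign `s` in `IsLabelledTree` records which of the two kinds carries the label
condition. Conversely three trees can be glued (`isLabelledTree_glue_iff`), and the parts are
determined by the result (`glue_injective`). With a weight for each label this gives functional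
equations for the generating functions `A i` of the trees with root label `i`
(`treeSeries_one`): `A i = 1 + X A i A 1 (y 1 A 1 + ⋯ + y (k + 1 - i) A (k + 1 - i))`, where `y j`
is the weight of the label `j`.

For unit weights the products `A i * A (k + 1 - i)` are all equal, whence `A i = u ^ (k + 1 - i)`
with `u = 1 + X u ^ (2k + 1)` (`system_solution`). Giving the label `h` the weight `1 + ε` with
`ε ^ 2 = 0` counts the vertices labelled `h`; the equations for the coefficients of `ε` are linear
and determine the logarithmic derivative of `A 1` (`linear_system_solution`). The number of trees is
then a coefficient of `u ^ (-k) - u ^ (-2k)`, and the number of vertices labelled `h` in all of them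
is a coefficient of a combination of the series `X (u ^ (-r))'` with `r` among `k`, `k + 1`, `2k`
and `2k + 1` (`exists_fuss_series`). The coefficients of all integral powers of `u` follow from the
recursion `u ^ r = u ^ (r - 1) + X u ^ (r + 2k)` (`coeff_zpow_fuss`), which gives the exact average.

The quotient of rising factorials is the quotient of the two binomial coefficients in the number of
trees. It is at most `(1 + 1 / (2k)) ^ k < 2` and differs from that power by `O(1 / n)`, which gives
the nonvanishing of the denominators, the existence of trees, and the asymptotic expansion.
-/

/-! ### Reachability after removing an edge -/

/-- `G` without the edge between `x` and `y`. -/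
def cutEdge {V : Type*} (G : SimpleGraph V) (x y : V) : SimpleGraph V :=
  G.deleteEdges {s(x, y)}

lemma cutEdge_adj {V : Type*} {G : SimpleGraph V} {x y u v : V} :
    (cutEdge G x y).Adj u v ↔
      G.Adj u v ∧ ¬ ((u = x ∧ v = y) ∨ (u = y ∧ v = x)) := by
  simp [cutEdge, SimpleGraph.deleteEdges_adj]

lemma cutEdge_comm {V : Type*} (G : SimpleGraph V) (x y : V) : cutEdge G x y = cutEdge G y x := by
  simp [cutEdge, Sym2.eq_swap]

lemma cutEdge_self {V : Type*} (G : SimpleGraph V) (x : V) : cutEdge G x x = G := by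
  ext u v
  rw [cutEdge_adj]
  refine ⟨fun h => h.1, fun h => ⟨h, ?_⟩⟩
  rintro (⟨rfl, rfl⟩ | ⟨rfl, rfl⟩) <;> exact h.ne rfl

lemma cutEdge_le {V : Type*} (G : SimpleGraph V) (x y : V) : cutEdge G x y ≤ G :=
  fun _ _ h => (cutEdge_adj.1 h).1

/-- A map that sends edges to pairs of mutually reachable vertices preserves reachability. -/
lemma reachable_map {V W : Type*} {G : SimpleGraph V} {H : SimpleGraph W} (f : V → W)
    (h : ∀ x y, G.Adj x y → H.Reachable (f x) (f y)) {u v : V} (huv : G.Reachable u v) :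
    H.Reachable (f u) (f v) := by
  obtain ⟨p⟩ := huv
  induction p with
  | nil => exact .refl _
  | cons hadj _ ih => exact (h _ _ hadj).trans ih

/-- A reachable pair separated by a set is joined through an edge that leaves the set. -/
lemma exists_adj_of_reachable {V : Type*} {G : SimpleGraph V} {u v : V} (S : Set V)
    (huv : G.Reachable u v) (hu : u ∈ S) (hv : v ∉ S) :
    ∃ x y, G.Adj x y ∧ G.Reachable u x ∧ x ∈ S ∧ y ∉ S := by
  obtain ⟨p⟩ := huv
  induction p with
  | nil => exact absurd hu hv
  | @cons u w v hadj p ih =>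
    by_cases hw : w ∈ S
    · obtain ⟨x, y, h1, h2, h3, h4⟩ := ih hw hv
      exact ⟨x, y, h1, hadj.reachable.trans h2, h3, h4⟩
    · exact ⟨u, w, hadj, .refl _, hu, hw⟩

/-! ### Labelled noncrossing trees on integer intervals -/

/-- A graph on `ℤ` together with vertex labels. Outside of the interval that carries the tree the
graph has no edges and the label is the junk value `0`. -/
abbrev LabelledGraph := SimpleGraph ℤ × (ℤ → ℕ)

/-- `T` lives on the interval `[0, n]`: its edges do, and its labels are in `{1, …, k}` there and
vanish elsewhere; the root `0` is labelled `i`. -/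
structure IsSupported (k i n : ℕ) (T : LabelledGraph) : Prop where
  supp : ∀ x y, T.1.Adj x y → 0 ≤ x ∧ x ≤ n
  label_pos : ∀ x : ℤ, 0 ≤ x → x ≤ n → 1 ≤ T.2 x
  label_le : ∀ x : ℤ, 0 ≤ x → x ≤ n → T.2 x ≤ k
  label_neg : ∀ x, x < 0 → T.2 x = 0
  label_gt : ∀ x, (n : ℤ) < x → T.2 x = 0
  label_root : T.2 0 = i

/-- `T` is a labelled noncrossing tree on `[0, n]`, rooted at `0`. For `s = 1` the label condition
is imposed on the edges whose parent is the smaller endpoint, for `s = -1` on those whose parent is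
the larger endpoint. That `x` is the parent of `y` is expressed by saying that `x` is still
reachable from the root when the edge `xy` is removed, and acyclicity by saying that every edge is
a bridge. -/
structure IsLabelledTree (k : ℕ) (s : ℤ) (i n : ℕ) (T : LabelledGraph) : Prop
    extends IsSupported k i n T where
  conn : ∀ x : ℤ, 0 ≤ x → x ≤ n → T.1.Reachable 0 x
  bridge : ∀ x y, T.1.Adj x y → ¬ (cutEdge T.1 x y).Reachable x y
  noncrossing : ∀ a b c d, a < b → b < c → c < d → ¬ (T.1.Adj a c ∧ T.1.Adj b d)
  label_add : ∀ x y, T.1.Adj x y → 0 < s * (y - x) → (cutEdge T.1 x y).Reachable 0 x →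
    T.2 x + T.2 y ≤ k + 1

/-! ### Gluing three trees -/

/-- The tree obtained from a tree on `[0, n₁]`, the mirror image of a tree on `[0, n₂]`, placed on
`[n₁ + 1, c]` with its root at `c = n₁ + n₂ + 1`, and a tree placed on `[c, …]`, by adding the
edge from `0` to `c`. The label of `c` is that of the root of the middle tree; the definition is
used only when the third tree has the same root label. -/
def glue (n₁ n₂ : ℕ) (T₁ T₂ T₃ : LabelledGraph) : LabelledGraph :=
  let c : ℤ := n₁ + n₂ + 1
  (T₁.1 ⊔ T₂.1.comap (fun x => c - x) ⊔ T₃.1.comap (fun x => x - c) ⊔ SimpleGraph.edge 0 c,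
    fun x => if x ≤ n₁ then T₁.2 x else if x ≤ c then T₂.2 (c - x) else T₃.2 (x - c))

lemma glue_adj {n₁ n₂ : ℕ} {T₁ T₂ T₃ : LabelledGraph} {x y : ℤ} :
    (glue n₁ n₂ T₁ T₂ T₃).1.Adj x y ↔
      T₁.1.Adj x y ∨ T₂.1.Adj (n₁ + n₂ + 1 - x) (n₁ + n₂ + 1 - y) ∨
      T₃.1.Adj (x - (n₁ + n₂ + 1)) (y - (n₁ + n₂ + 1)) ∨
      (x = 0 ∧ y = n₁ + n₂ + 1) ∨ (x = n₁ + n₂ + 1 ∧ y = 0) := by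
  simp only [glue, SimpleGraph.sup_adj, SimpleGraph.comap_adj, SimpleGraph.edge_adj]
  constructor
  · rintro (((h | h) | h) | ⟨h | h, -⟩) <;> tauto
  · rintro (h | h | h | h | h)
    · tauto
    · tauto
    · tauto
    · exact Or.inr ⟨Or.inl h, by omega⟩
    · exact Or.inr ⟨Or.inr h, by omega⟩

section glue
variable {k i₁ i₂ i₃ n₁ n₂ n₃ : ℕ} {T₁ T₂ T₃ : LabelledGraph}

lemma IsSupported.supp' {k i n : ℕ} {T : LabelledGraph} (h : IsSupported k i n T) {x y : ℤ}
    (hxy : T.1.Adj x y) : 0 ≤ x ∧ x ≤ n ∧ 0 ≤ y ∧ y ≤ n :=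
  ⟨(h.supp x y hxy).1, (h.supp x y hxy).2, (h.supp y x hxy.symm).1, (h.supp y x hxy.symm).2⟩

/-- The four kinds of edges of a glued tree, with the intervals that contain them. -/
lemma glue_adj_cases (h₁ : IsSupported k i₁ n₁ T₁) (h₂ : IsSupported k i₂ n₂ T₂)
    (h₃ : IsSupported k i₃ n₃ T₃) {x y : ℤ} (h : (glue n₁ n₂ T₁ T₂ T₃).1.Adj x y) :
    (T₁.1.Adj x y ∧ 0 ≤ x ∧ x ≤ n₁ ∧ 0 ≤ y ∧ y ≤ n₁) ∨
    (T₂.1.Adj (n₁ + n₂ + 1 - x) (n₁ + n₂ + 1 - y) ∧ n₁ + 1 ≤ x ∧ x ≤ n₁ + n₂ + 1 ∧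
      n₁ + 1 ≤ y ∧ y ≤ n₁ + n₂ + 1) ∨
    (T₃.1.Adj (x - (n₁ + n₂ + 1)) (y - (n₁ + n₂ + 1)) ∧ n₁ + n₂ + 1 ≤ x ∧
      x ≤ n₁ + n₂ + 1 + n₃ ∧ n₁ + n₂ + 1 ≤ y ∧ y ≤ n₁ + n₂ + 1 + n₃) ∨
      (x = 0 ∧ y = n₁ + n₂ + 1) ∨ (x = n₁ + n₂ + 1 ∧ y = 0) := by
  rw [glue_adj] at h
  rcases h with h | h | h | h | h
  · exact Or.inl ⟨h, h₁.supp' h⟩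
  · refine Or.inr (Or.inl ⟨h, ?_⟩)
    have := h₂.supp' h
    omega
  · refine Or.inr (Or.inr (Or.inl ⟨h, ?_⟩))
    have := h₃.supp' h
    omega
  · tauto
  · tauto

/-- Collapsing the other two parts to the root of the first part maps walks in a glued tree to
walks in the first part. The next two lemmas collapse to the roots of the other parts. -/
lemma reachable_of_glue₁ (h₁ : IsSupported k i₁ n₁ T₁) (h₂ : IsSupported k i₂ n₂ T₂)
    (h₃ : IsSupported k i₃ n₃ T₃) {x y u v : ℤ}
    (huv : (cutEdge (glue n₁ n₂ T₁ T₂ T₃).1 x y).Reachable u v) :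
    (cutEdge T₁.1 x y).Reachable (if u ≤ n₁ then u else 0) (if v ≤ n₁ then v else 0) := by
  refine reachable_map (fun u : ℤ => if u ≤ n₁ then u else 0) (fun a b hab => ?_) huv
  rw [cutEdge_adj] at hab
  rcases glue_adj_cases h₁ h₂ h₃ hab.1 with h | h | h | h | h
  · simp only [h.2, if_true]
    exact (cutEdge_adj.2 ⟨h.1, hab.2⟩ : (cutEdge T₁.1 x y).Adj a b).reachable
  all_goals split_ifs <;> first | omega | exact .refl _ | simp_all

lemma reachable_of_glue₂ (h₁ : IsSupported k i₁ n₁ T₁) (h₂ : IsSupported k i₂ n₂ T₂)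
    (h₃ : IsSupported k i₃ n₃ T₃) {x y u v : ℤ}
    (huv : (cutEdge (glue n₁ n₂ T₁ T₂ T₃).1 x y).Reachable u v) :
    (cutEdge T₂.1 (n₁ + n₂ + 1 - x) (n₁ + n₂ + 1 - y)).Reachable
      (if n₁ < u ∧ u ≤ n₁ + n₂ + 1 then n₁ + n₂ + 1 - u else 0)
      (if n₁ < v ∧ v ≤ n₁ + n₂ + 1 then n₁ + n₂ + 1 - v else 0) := by
  refine reachable_map
    (fun u : ℤ => if n₁ < u ∧ u ≤ n₁ + n₂ + 1 then n₁ + n₂ + 1 - u else 0) (fun a b hab => ?_) huv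
  rw [cutEdge_adj] at hab
  rcases glue_adj_cases h₁ h₂ h₃ hab.1 with h | h | h | h | h
  rotate_left
  · rw [if_pos (by omega), if_pos (by omega)]
    exact (cutEdge_adj.2 ⟨h.1, by omega⟩ : (cutEdge T₂.1 _ _).Adj _ _).reachable
  all_goals
    have e (w : ℤ) (hw : w ≤ n₁ ∨ n₁ + n₂ + 1 ≤ w) :
        (if n₁ < w ∧ w ≤ n₁ + n₂ + 1 then n₁ + n₂ + 1 - w else (0 : ℤ)) = 0 := by
      split_ifs <;> omega
    rw [e a (by omega), e b (by omega)]

lemma reachable_of_glue₃ (h₁ : IsSupported k i₁ n₁ T₁) (h₂ : IsSupported k i₂ n₂ T₂)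
    (h₃ : IsSupported k i₃ n₃ T₃) {x y u v : ℤ}
    (huv : (cutEdge (glue n₁ n₂ T₁ T₂ T₃).1 x y).Reachable u v) :
    (cutEdge T₃.1 (x - (n₁ + n₂ + 1)) (y - (n₁ + n₂ + 1))).Reachable
      (if n₁ + n₂ + 1 ≤ u then u - (n₁ + n₂ + 1) else 0)
      (if n₁ + n₂ + 1 ≤ v then v - (n₁ + n₂ + 1) else 0) := by
  refine reachable_map
    (fun u : ℤ => if n₁ + n₂ + 1 ≤ u then u - (n₁ + n₂ + 1) else 0) (fun a b hab => ?_) huv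
  rw [cutEdge_adj] at hab
  rcases glue_adj_cases h₁ h₂ h₃ hab.1 with h | h | h | h | h
  rotate_right 3
  · rw [if_pos (by omega), if_pos (by omega)]
    exact (cutEdge_adj.2 ⟨h.1, by omega⟩ : (cutEdge T₃.1 _ _).Adj _ _).reachable
  all_goals
    have e (w : ℤ) (hw : w ≤ n₁ + n₂ + 1) :
        (if n₁ + n₂ + 1 ≤ w then w - (n₁ + n₂ + 1) else (0 : ℤ)) = 0 := by
      split_ifs <;> omega
    rw [e a (by omega), e b (by omega)]

lemma glue_reachable₁ {x y u v : ℤ} (huv : (cutEdge T₁.1 x y).Reachable u v) :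
    (cutEdge (glue n₁ n₂ T₁ T₂ T₃).1 x y).Reachable u v := by
  refine reachable_map id (fun a b hab => ?_) huv
  rw [cutEdge_adj] at hab
  exact (cutEdge_adj.2 ⟨glue_adj.2 (Or.inl hab.1), hab.2⟩ : (cutEdge _ x y).Adj a b).reachable

lemma glue_reachable₂ {x y u v : ℤ} (huv : (cutEdge T₂.1 x y).Reachable u v) :
    (cutEdge (glue n₁ n₂ T₁ T₂ T₃).1 (n₁ + n₂ + 1 - x) (n₁ + n₂ + 1 - y)).Reachable
      (n₁ + n₂ + 1 - u) (n₁ + n₂ + 1 - v) := by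
  refine reachable_map (fun u : ℤ => n₁ + n₂ + 1 - u) (fun a b hab => ?_) huv
  rw [cutEdge_adj] at hab
  refine SimpleGraph.Adj.reachable (cutEdge_adj.2 ⟨glue_adj.2 (Or.inr (Or.inl ?_)), by omega⟩)
  simpa using hab.1

lemma glue_reachable₃ {x y u v : ℤ} (huv : (cutEdge T₃.1 x y).Reachable u v) :
    (cutEdge (glue n₁ n₂ T₁ T₂ T₃).1 (x + (n₁ + n₂ + 1)) (y + (n₁ + n₂ + 1))).Reachable
      (u + (n₁ + n₂ + 1)) (v + (n₁ + n₂ + 1)) := by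
  refine reachable_map (fun u : ℤ => u + (n₁ + n₂ + 1)) (fun a b hab => ?_) huv
  rw [cutEdge_adj] at hab
  refine SimpleGraph.Adj.reachable
    (cutEdge_adj.2 ⟨glue_adj.2 (Or.inr (Or.inr (Or.inl ?_))), by omega⟩)
  simpa using hab.1

/-- The new edge of a glued tree is a bridge. -/
lemma not_reachable_glue (h₁ : IsSupported k i₁ n₁ T₁) (h₂ : IsSupported k i₂ n₂ T₂)
    (h₃ : IsSupported k i₃ n₃ T₃) :
    ¬ (cutEdge (glue n₁ n₂ T₁ T₂ T₃).1 0 (n₁ + n₂ + 1)).Reachable 0 (n₁ + n₂ + 1) := by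
  intro h
  have : (⊥ : SimpleGraph Prop).Reachable ((0 : ℤ) ≤ n₁) ((n₁ + n₂ + 1 : ℤ) ≤ n₁) := by
    refine reachable_map (fun u : ℤ => u ≤ n₁) (fun a b hab => ?_) h
    rw [cutEdge_adj] at hab
    have : (a ≤ n₁) = (b ≤ n₁) := by
      rcases glue_adj_cases h₁ h₂ h₃ hab.1 with h | h | h | h | h <;> ext <;> omega
    rw [this]
  rw [SimpleGraph.reachable_bot] at this
  have h0 : (0 : ℤ) ≤ n₁ := by omega
  rw [this] at h0
  omega

end glue

section glue
variable {k i j n₁ n₂ n₃ : ℕ} {T₁ T₂ T₃ : LabelledGraph}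

lemma glue_label₁ {x : ℤ} (hx : x ≤ n₁) : (glue n₁ n₂ T₁ T₂ T₃).2 x = T₁.2 x := by
  simp [glue, hx]

lemma glue_label₂ {x : ℤ} (hx : n₁ < x) (hx' : x ≤ n₁ + n₂ + 1) :
    (glue n₁ n₂ T₁ T₂ T₃).2 x = T₂.2 (n₁ + n₂ + 1 - x) := by
  simp [glue, hx.not_ge, hx']

lemma glue_label₃ (h₂ : IsSupported k j n₂ T₂) (h₃ : IsSupported k j n₃ T₃) {x : ℤ}
    (hx : n₁ + n₂ + 1 ≤ x) :
    (glue n₁ n₂ T₁ T₂ T₃).2 x = T₃.2 (x - (n₁ + n₂ + 1)) := by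
  have h : ¬ x ≤ n₁ := by omega
  simp only [glue, h, if_false]
  split_ifs with h'
  · obtain rfl : x = n₁ + n₂ + 1 := by omega
    simp [h₂.label_root, h₃.label_root]
  · rfl

lemma isSupported_glue (h₁ : IsSupported k i n₁ T₁) (h₂ : IsSupported k j n₂ T₂)
    (h₃ : IsSupported k j n₃ T₃) : IsSupported k i (n₁ + n₂ + n₃ + 1) (glue n₁ n₂ T₁ T₂ T₃) := by
  have key : ∀ x : ℤ, (∃ y, x = y ∧ y ≤ n₁ ∧ (glue n₁ n₂ T₁ T₂ T₃).2 x = T₁.2 y) ∨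
      (∃ y, x = n₁ + n₂ + 1 - y ∧ 0 ≤ y ∧ y ≤ n₂ ∧ (glue n₁ n₂ T₁ T₂ T₃).2 x = T₂.2 y) ∨
      (∃ y, x = n₁ + n₂ + 1 + y ∧ 0 ≤ y ∧ (glue n₁ n₂ T₁ T₂ T₃).2 x = T₃.2 y) := by
    intro x
    rcases le_or_gt x n₁ with h | h
    · exact Or.inl ⟨x, rfl, h, glue_label₁ h⟩
    rcases le_or_gt x (n₁ + n₂ + 1) with h' | h'
    · exact Or.inr (Or.inl ⟨_, by ring, by omega, by omega, glue_label₂ h h'⟩)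
    · exact Or.inr (Or.inr ⟨_, by ring, by omega, glue_label₃ h₂ h₃ h'.le⟩)
  constructor
  · intro x y h
    rcases glue_adj_cases h₁ h₂ h₃ h with h | h | h | h | h <;> push_cast <;> omega
  · intro x hx hx'
    rcases key x with ⟨y, rfl, hy, e⟩ | ⟨y, rfl, hy, hy', e⟩ | ⟨y, rfl, hy, e⟩ <;> rw [e]
    · exact h₁.label_pos _ hx hy
    · exact h₂.label_pos _ hy hy'
    · exact h₃.label_pos _ hy (by push_cast at hx'; omega)
  · intro x hx hx'
    rcases key x with ⟨y, rfl, hy, e⟩ | ⟨y, rfl, hy, hy', e⟩ | ⟨y, rfl, hy, e⟩ <;> rw [e]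
    · exact h₁.label_le _ hx hy
    · exact h₂.label_le _ hy hy'
    · exact h₃.label_le _ hy (by push_cast at hx'; omega)
  · intro x hx
    rw [glue_label₁ (by omega)]
    exact h₁.label_neg x hx
  · intro x hx
    push_cast at hx
    rw [glue_label₃ h₂ h₃ (by omega)]
    exact h₃.label_gt _ (by omega)
  · rw [glue_label₁ (by omega)]
    exact h₁.label_root

lemma adj_glue₁ (h₁ : IsSupported k i n₁ T₁) (h₂ : IsSupported k j n₂ T₂)
    (h₃ : IsSupported k j n₃ T₃) {x y : ℤ} :
    T₁.1.Adj x y ↔ (glue n₁ n₂ T₁ T₂ T₃).1.Adj x y ∧ x ≤ n₁ ∧ y ≤ n₁ := by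
  refine ⟨fun h => ⟨glue_adj.2 (Or.inl h), ?_⟩, fun h => ?_⟩
  · have := h₁.supp' h
    omega
  · rcases glue_adj_cases h₁ h₂ h₃ h.1 with h | h | h | h | h
    · exact h.1
    all_goals omega

lemma adj_glue₂ (h₁ : IsSupported k i n₁ T₁) (h₂ : IsSupported k j n₂ T₂)
    (h₃ : IsSupported k j n₃ T₃) {x y : ℤ} :
    T₂.1.Adj x y ↔ (glue n₁ n₂ T₁ T₂ T₃).1.Adj (n₁ + n₂ + 1 - x) (n₁ + n₂ + 1 - y) ∧
      0 ≤ x ∧ x ≤ n₂ ∧ 0 ≤ y ∧ y ≤ n₂ := by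
  refine ⟨fun h => ⟨glue_adj.2 (Or.inr (Or.inl (by simpa using h))), h₂.supp' h⟩, fun h => ?_⟩
  rcases glue_adj_cases h₁ h₂ h₃ h.1 with h' | h' | h' | h' | h'
  · omega
  · simpa using h'.1
  · exact absurd h.1.ne (by omega)
  all_goals omega

lemma adj_glue₃ (h₁ : IsSupported k i n₁ T₁) (h₂ : IsSupported k j n₂ T₂)
    (h₃ : IsSupported k j n₃ T₃) {x y : ℤ} :
    T₃.1.Adj x y ↔ (glue n₁ n₂ T₁ T₂ T₃).1.Adj (x + (n₁ + n₂ + 1)) (y + (n₁ + n₂ + 1)) ∧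
      0 ≤ x ∧ 0 ≤ y := by
  refine ⟨fun h => ⟨glue_adj.2 (Or.inr (Or.inr (Or.inl (by simpa using h)))), ?_⟩, fun h => ?_⟩
  · have := h₃.supp' h
    omega
  rcases glue_adj_cases h₁ h₂ h₃ h.1 with h' | h' | h' | h' | h'
  · omega
  · exact absurd h.1.ne (by omega)
  · simpa using h'.1
  all_goals omega

/-- A glued graph is a labelled tree precisely if its three parts are. The middle part is
reflected, which is why its label condition concerns the opposite direction of edges. -/
lemma isLabelledTree_glue_iff {s : ℤ} (h₁ : IsSupported k i n₁ T₁) (h₂ : IsSupported k j n₂ T₂)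
    (h₃ : IsSupported k j n₃ T₃) :
    IsLabelledTree k s i (n₁ + n₂ + n₃ + 1) (glue n₁ n₂ T₁ T₂ T₃) ↔
      IsLabelledTree k s i n₁ T₁ ∧ IsLabelledTree k (-s) j n₂ T₂ ∧ IsLabelledTree k s j n₃ T₃ ∧
        (0 < s → i + j ≤ k + 1) := by
  have hnew : (glue n₁ n₂ T₁ T₂ T₃).1.Adj 0 (n₁ + n₂ + 1) :=
    glue_adj.2 (Or.inr (Or.inr (Or.inr (Or.inl ⟨rfl, rfl⟩))))
  have hroot : (glue n₁ n₂ T₁ T₂ T₃).2 0 = i := by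
    rw [glue_label₁ (by omega), h₁.label_root]
  have hc : (glue n₁ n₂ T₁ T₂ T₃).2 (n₁ + n₂ + 1) = j := by
    rw [glue_label₂ (by omega) le_rfl, sub_self, h₂.label_root]
  have hcut {x y : ℤ} (h : ¬ ((x = 0 ∧ y = n₁ + n₂ + 1) ∨ (x = n₁ + n₂ + 1 ∧ y = 0))) :
      (cutEdge (glue n₁ n₂ T₁ T₂ T₃).1 x y).Adj 0 (n₁ + n₂ + 1) :=
    cutEdge_adj.2 ⟨hnew, by omega⟩
  constructor
  · intro h
    refine ⟨⟨h₁, ?_, ?_, ?_, ?_⟩, ⟨h₂, ?_, ?_, ?_, ?_⟩, ⟨h₃, ?_, ?_, ?_, ?_⟩, ?_⟩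
    · intro x hx hx'
      have := h.conn x hx (by push_cast; omega)
      rw [← cutEdge_self (glue n₁ n₂ T₁ T₂ T₃).1 0] at this
      have := reachable_of_glue₁ h₁ h₂ h₃ this
      rwa [cutEdge_self, if_pos (by omega), if_pos hx'] at this
    · intro x y hxy hr
      exact h.bridge x y ((adj_glue₁ h₁ h₂ h₃).1 hxy).1 (glue_reachable₁ hr)
    · intro a b c d hab hbc hcd hh
      exact h.noncrossing a b c d hab hbc hcd
        ⟨((adj_glue₁ h₁ h₂ h₃).1 hh.1).1, ((adj_glue₁ h₁ h₂ h₃).1 hh.2).1⟩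
    · intro x y hxy hs hr
      have := h.label_add x y ((adj_glue₁ h₁ h₂ h₃).1 hxy).1 hs (glue_reachable₁ hr)
      have b := h₁.supp' hxy
      rwa [glue_label₁ (by omega), glue_label₁ (by omega)] at this
    · intro x hx hx'
      have := (hnew.reachable.symm).trans
        (h.conn (n₁ + n₂ + 1 - x) (by omega) (by push_cast; omega))
      rw [← cutEdge_self (glue n₁ n₂ T₁ T₂ T₃).1 0] at this
      have := reachable_of_glue₂ h₁ h₂ h₃ this
      rw [cutEdge_self, if_pos (by omega), if_pos (by omega)] at this
      simpa using this
    · intro x y hxy hr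
      exact h.bridge _ _ ((adj_glue₂ h₁ h₂ h₃).1 hxy).1 (glue_reachable₂ hr)
    · intro a b c d hab hbc hcd hh
      exact h.noncrossing (n₁ + n₂ + 1 - d) (n₁ + n₂ + 1 - c) (n₁ + n₂ + 1 - b) (n₁ + n₂ + 1 - a)
        (by omega) (by omega) (by omega)
        ⟨((adj_glue₂ h₁ h₂ h₃).1 hh.2).1.symm, ((adj_glue₂ h₁ h₂ h₃).1 hh.1).1.symm⟩
    · intro x y hxy hs hr
      have b := h₂.supp' hxy
      have hr' := glue_reachable₂ (n₁ := n₁) (n₂ := n₂) (T₁ := T₁) (T₃ := T₃) hr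
      rw [sub_zero] at hr'
      have := h.label_add _ _ ((adj_glue₂ h₁ h₂ h₃).1 hxy).1
        (by rw [show s * ((n₁ + n₂ + 1 - y : ℤ) - (n₁ + n₂ + 1 - x)) = -s * (y - x) by ring]
            exact hs)
        ((hcut (by omega)).reachable.trans hr')
      rw [glue_label₂ (by omega) (by omega), glue_label₂ (by omega) (by omega)] at this
      simpa using this
    · intro x hx hx'
      have := (hnew.reachable.symm).trans
        (h.conn (x + (n₁ + n₂ + 1)) (by omega) (by push_cast; omega))
      rw [← cutEdge_self (glue n₁ n₂ T₁ T₂ T₃).1 0] at this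
      have := reachable_of_glue₃ h₁ h₂ h₃ this
      rw [cutEdge_self, if_pos (by omega), if_pos (by omega)] at this
      simpa using this
    · intro x y hxy hr
      exact h.bridge _ _ ((adj_glue₃ h₁ h₂ h₃).1 hxy).1 (glue_reachable₃ hr)
    · intro a b c d hab hbc hcd hh
      exact h.noncrossing _ _ _ _ (by omega) (by omega) (by omega)
        ⟨((adj_glue₃ h₁ h₂ h₃).1 hh.1).1, ((adj_glue₃ h₁ h₂ h₃).1 hh.2).1⟩
    · intro x y hxy hs hr
      have b := h₃.supp' hxy
      have hr' := glue_reachable₃ (n₁ := n₁) (n₂ := n₂) (T₁ := T₁) (T₂ := T₂) hr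
      rw [zero_add] at hr'
      have := h.label_add _ _ ((adj_glue₃ h₁ h₂ h₃).1 hxy).1
        (by rwa [add_sub_add_right_eq_sub])
        ((hcut (by omega)).reachable.trans hr')
      rw [glue_label₃ h₂ h₃ (by omega), glue_label₃ h₂ h₃ (by omega)] at this
      simpa using this
    · intro hs
      have := h.label_add 0 (n₁ + n₂ + 1) hnew (mul_pos hs (by omega)) (.refl _)
      rwa [hroot, hc] at this
  · rintro ⟨t₁, t₂, t₃, hs⟩
    refine ⟨isSupported_glue h₁ h₂ h₃, ?_, ?_, ?_, ?_⟩
    · intro x hx hx'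
      push_cast at hx'
      rw [← cutEdge_self (glue n₁ n₂ T₁ T₂ T₃).1 0]
      rcases le_or_gt x n₁ with h | h
      · refine glue_reachable₁ ?_
        rw [cutEdge_self]
        exact t₁.conn x hx h
      rw [cutEdge_self]
      refine hnew.reachable.trans ?_
      rw [← cutEdge_self (glue n₁ n₂ T₁ T₂ T₃).1 (n₁ + n₂ + 1)]
      rcases le_or_gt x (n₁ + n₂ + 1) with h' | h'
      · have := t₂.conn (n₁ + n₂ + 1 - x) (by omega) (by omega)
        rw [← cutEdge_self T₂.1 0] at this
        simpa using glue_reachable₂ (n₁ := n₁) (n₂ := n₂) (T₁ := T₁) (T₃ := T₃) this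
      · have := t₃.conn (x - (n₁ + n₂ + 1)) (by omega) (by omega)
        rw [← cutEdge_self T₃.1 0] at this
        simpa using glue_reachable₃ (n₁ := n₁) (n₂ := n₂) (T₁ := T₁) (T₂ := T₂) this
    · intro x y hxy hr
      rcases glue_adj_cases h₁ h₂ h₃ hxy with h | h | h | ⟨rfl, rfl⟩ | ⟨rfl, rfl⟩
      · have := reachable_of_glue₁ h₁ h₂ h₃ hr
        rw [if_pos (by omega), if_pos (by omega)] at this
        exact t₁.bridge _ _ h.1 this
      · have := reachable_of_glue₂ h₁ h₂ h₃ hr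
        rw [if_pos (by omega), if_pos (by omega)] at this
        exact t₂.bridge _ _ h.1 this
      · have := reachable_of_glue₃ h₁ h₂ h₃ hr
        rw [if_pos (by omega), if_pos (by omega)] at this
        exact t₃.bridge _ _ h.1 this
      · exact not_reachable_glue h₁ h₂ h₃ hr
      · rw [cutEdge_comm] at hr
        exact not_reachable_glue h₁ h₂ h₃ hr.symm
    · intro a b c d hab hbc hcd ⟨hac, hbd⟩
      rcases glue_adj_cases h₁ h₂ h₃ hac with h | h | h | h | h <;>
      rcases glue_adj_cases h₁ h₂ h₃ hbd with h' | h' | h' | h' | h' <;>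
      first
      | omega
      | exact t₁.noncrossing _ _ _ _ hab hbc hcd ⟨h.1, h'.1⟩
      | exact t₂.noncrossing _ _ _ _ (by omega) (by omega) (by omega) ⟨h'.1.symm, h.1.symm⟩
      | exact t₃.noncrossing _ _ _ _ (by omega) (by omega) (by omega) ⟨h.1, h'.1⟩
    · intro x y hxy hsxy hr
      rcases glue_adj_cases h₁ h₂ h₃ hxy with h | h | h | ⟨rfl, rfl⟩ | ⟨rfl, rfl⟩
      · have := reachable_of_glue₁ h₁ h₂ h₃ hr
        rw [if_pos (by omega), if_pos (by omega)] at this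
        rw [glue_label₁ (by omega), glue_label₁ (by omega)]
        exact t₁.label_add _ _ h.1 hsxy this
      · have := reachable_of_glue₂ h₁ h₂ h₃ hr
        rw [if_neg (by omega), if_pos (by omega)] at this
        rw [glue_label₂ (by omega) (by omega), glue_label₂ (by omega) (by omega)]
        refine t₂.label_add _ _ h.1 ?_ this
        rw [show -s * ((n₁ + n₂ + 1 - y : ℤ) - (n₁ + n₂ + 1 - x)) = s * (y - x) by ring]
        exact hsxy
      · have := reachable_of_glue₃ h₁ h₂ h₃ hr
        rw [if_neg (by omega), if_pos (by omega)] at this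
        rw [glue_label₃ h₂ h₃ (by omega), glue_label₃ h₂ h₃ (by omega)]
        exact t₃.label_add _ _ h.1 (by rwa [sub_sub_sub_cancel_right]) this
      · rw [hroot, hc]
        exact hs (pos_of_mul_pos_left (by simpa using hsxy) (by positivity))
      · rw [cutEdge_comm] at hr
        exact absurd hr (not_reachable_glue h₁ h₂ h₃)

end glue

/-! ### Decomposing a tree at the last child of the root -/

/-- In a noncrossing tree on `[0, N + 1]`, let `c` be the
largest neighbour of the root. The component of `0` that remains after removing the edge from `0`
to `c` is an interval `[0, n₁]`, and no edge passes over `c`. -/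
lemma IsLabelledTree.exists_split {k i N : ℕ} {s : ℤ} {T : LabelledGraph}
    (h : IsLabelledTree k s i (N + 1) T) :
    ∃ n₁ n₂ n₃ : ℕ, n₁ + n₂ + n₃ = N ∧ T.1.Adj 0 (n₁ + n₂ + 1) ∧
      ∀ x y, T.1.Adj x y → (x ≤ n₁ ∧ y ≤ n₁) ∨
        (n₁ + 1 ≤ x ∧ x ≤ n₁ + n₂ + 1 ∧ n₁ + 1 ≤ y ∧ y ≤ n₁ + n₂ + 1) ∨
        (n₁ + n₂ + 1 ≤ x ∧ n₁ + n₂ + 1 ≤ y) ∨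
        (x = 0 ∧ y = n₁ + n₂ + 1) ∨ (x = n₁ + n₂ + 1 ∧ y = 0) := by
  have supp {x y : ℤ} (hxy : T.1.Adj x y) := h.toIsSupported.supp' hxy
  push_cast at supp
  obtain ⟨c, hc, hmax⟩ : ∃ c, T.1.Adj 0 c ∧ ∀ z, T.1.Adj 0 z → z ≤ c := by
    refine Int.exists_greatest_of_bdd ⟨N + 1, fun z hz => (supp hz).2.2.2⟩ ?_
    obtain ⟨x, y, hxy, -, hx, -⟩ := exists_adj_of_reachable {0}
      (h.conn 1 (by omega) (by push_cast; omega)) rfl (by simp)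
    obtain rfl : x = 0 := hx
    exact ⟨y, hxy⟩
  have hc0 : 0 < c := lt_of_le_of_ne (supp hc).2.2.1 hc.ne
  set H := cutEdge T.1 0 c with hH
  have hHT {x y : ℤ} (hxy : H.Adj x y) : T.1.Adj x y := (cutEdge_adj.1 hxy).1
  have hdisj {x : ℤ} (h0 : H.Reachable 0 x) (h1 : H.Reachable c x) : False :=
    h.bridge 0 c hc (h0.trans h1.symm)
  have hcover (x : ℤ) (hx : 0 ≤ x) (hx' : x ≤ N + 1) : H.Reachable 0 x ∨ H.Reachable c x := by
    by_contra hcon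
    obtain ⟨u, v, huv, -, hu, hv⟩ := exists_adj_of_reachable
      {x | H.Reachable 0 x ∨ H.Reachable c x} (h.conn x hx (by push_cast; omega))
      (Or.inl (.refl _)) hcon
    by_cases he : (u = 0 ∧ v = c) ∨ (u = c ∧ v = 0)
    · rcases he with ⟨-, rfl⟩ | ⟨-, rfl⟩
      · exact hv (Or.inr (.refl _))
      · exact hv (Or.inl (.refl _))
    · have : H.Adj u v := cutEdge_adj.2 ⟨huv, he⟩
      exact hv (hu.imp (·.trans this.reachable) (·.trans this.reachable))
  have hbound {x : ℤ} (hx : H.Reachable 0 x) : 0 ≤ x ∧ x ≤ N + 1 := by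
    by_contra hcon
    obtain ⟨u, v, huv, -, hu, hv⟩ := exists_adj_of_reachable
      {x : ℤ | 0 ≤ x ∧ x ≤ N + 1} hx ⟨le_rfl, by positivity⟩ hcon
    exact hv ⟨(supp (hHT huv)).2.2.1, (supp (hHT huv)).2.2.2⟩
  -- An edge leading beyond `c` from the component of `0` would be longer than the edge to `c` or
  -- cross it.
  have hlt {x : ℤ} (hx : H.Reachable 0 x) : x < c := by
    by_contra hcon
    obtain ⟨u, v, huv, h0u, hu, hv⟩ := exists_adj_of_reachable {x | x < c} hx hc0 hcon
    have h0v := h0u.trans huv.reachable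
    have hvc : c < v := lt_of_le_of_ne (not_lt.1 hv) (fun e => hdisj h0v (e ▸ .refl _))
    rcases (supp (hHT huv)).1.eq_or_lt with rfl | hu0
    · exact absurd (hmax v (hHT huv)) (not_le.2 hvc)
    · exact h.noncrossing 0 u c v hu0 hu hvc ⟨hc, hHT huv⟩
  obtain ⟨m, hm, hmmax⟩ : ∃ m, H.Reachable 0 m ∧ ∀ z, H.Reachable 0 z → z ≤ m :=
    Int.exists_greatest_of_bdd ⟨N + 1, fun z hz => (hbound hz).2⟩ ⟨0, .refl _⟩
  have hm0 := (hbound hm).1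
  have hmc := hlt hm
  -- A vertex below `m` in the component of `c` forces two crossing edges, one from each component.
  have hint {x : ℤ} (hx : 0 ≤ x) (hxm : x ≤ m) : H.Reachable 0 x := by
    rcases hcover x hx (by have := hbound hm; omega) with h0 | h1
    · exact h0
    exfalso
    have hxm' : x < m := lt_of_le_of_ne hxm (fun e => hdisj hm (e ▸ h1))
    obtain ⟨p, q, hpq, hxp, hp, hq⟩ := exists_adj_of_reachable {x | x < m} h1.symm hxm'
      (not_lt.2 hmc.le)
    have hcp := h1.trans hxp
    have hcq := hcp.trans hpq.reachable
    have hmq : m < q := lt_of_le_of_ne (not_lt.1 hq) (fun e => hdisj hm (e ▸ hcq))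
    have hp0 : 0 < p := lt_of_le_of_ne (supp (hHT hpq)).1 (fun e => hdisj (.refl _) (e ▸ hcp))
    obtain ⟨r, t, hrt, hmr, hr, ht⟩ := exists_adj_of_reachable {x | p < x ∧ x < q} hm.symm
      ⟨hp, hmq⟩ (fun hcon => hcon.1.not_gt hp0)
    have h0t := (hm.trans hmr).trans hrt.reachable
    have htp : t ≠ p := fun e => hdisj h0t (e ▸ hcp)
    have htq : t ≠ q := fun e => hdisj h0t (e ▸ hcq)
    rcases lt_or_gt_of_ne htp with h' | h'
    · exact h.noncrossing t p r q h' hr.1 hr.2 ⟨(hHT hrt).symm, hHT hpq⟩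
    · refine h.noncrossing p r q t hr.1 hr.2 ?_ ⟨hHT hpq, hHT hrt⟩
      exact lt_of_le_of_ne (not_lt.1 fun hlt => ht ⟨h', hlt⟩) htq.symm
  have hcb := (supp hc).2.2.2
  refine ⟨m.toNat, (c - m - 1).toNat, (N + 1 - c).toNat, by omega, ?_, fun x y hxy => ?_⟩
  · convert hc using 1; omega
  have e1 : (m.toNat : ℤ) = m := by omega
  have e2 : ((c - m - 1).toNat : ℤ) = c - m - 1 := by omega
  rw [e1, e2, show m + (c - m - 1) + 1 = c by ring]
  by_cases he : (x = 0 ∧ y = c) ∨ (x = c ∧ y = 0)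
  · tauto
  have hxy' : H.Adj x y := cutEdge_adj.2 ⟨hxy, he⟩
  have b := supp hxy
  by_cases hx : H.Reachable 0 x
  · exact Or.inl ⟨hmmax x hx, hmmax y (hx.trans hxy'.reachable)⟩
  · have hy : ¬ H.Reachable 0 y := fun hy => hx (hy.trans hxy'.symm.reachable)
    have hmx : m < x := not_le.1 fun hle => hx (hint b.1 hle)
    have hmy : m < y := not_le.1 fun hle => hy (hint b.2.2.1 hle)
    by_contra hcon
    rcases lt_trichotomy x c with h1 | h1 | h1
    · exact h.noncrossing 0 x c y (by omega) h1 (by omega) ⟨hc, hxy⟩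
    · omega
    · exact h.noncrossing 0 y c x (by omega) (by omega) h1 ⟨hc, hxy.symm⟩

/-- Every labelled tree with at least one edge is glued from three labelled graphs. That these are
trees again follows from `isLabelledTree_glue_iff`. -/
lemma IsLabelledTree.exists_glue {k i N : ℕ} {s : ℤ} {T : LabelledGraph}
    (h : IsLabelledTree k s i (N + 1) T) :
    ∃ n₁ n₂ n₃ j : ℕ, n₁ + n₂ + n₃ = N ∧ 1 ≤ j ∧ j ≤ k ∧ ∃ T₁ T₂ T₃,
      IsSupported k i n₁ T₁ ∧ IsSupported k j n₂ T₂ ∧ IsSupported k j n₃ T₃ ∧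
      T = glue n₁ n₂ T₁ T₂ T₃ := by
  obtain ⟨n₁, n₂, n₃, hN, hadj, hcases⟩ := h.exists_split
  have supp {x y : ℤ} (hxy : T.1.Adj x y) := h.toIsSupported.supp' hxy
  push_cast at supp
  have hN' : (n₁ + n₂ + n₃ : ℤ) = N := by exact_mod_cast hN
  have lpos (x : ℤ) (hx : 0 ≤ x) (hx' : x ≤ n₁ + n₂ + n₃ + 1) : 1 ≤ T.2 x ∧ T.2 x ≤ k :=
    ⟨h.label_pos x hx (by push_cast; omega), h.label_le x hx (by push_cast; omega)⟩
  have lgt (x : ℤ) (hx : n₁ + n₂ + n₃ + 1 < x) : T.2 x = 0 :=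
    h.label_gt x (by push_cast; omega)
  refine ⟨n₁, n₂, n₃, T.2 (n₁ + n₂ + 1), hN, (lpos _ (by omega) (by omega)).1,
    (lpos _ (by omega) (by omega)).2,
    ⟨⟨fun x y => T.1.Adj x y ∧ x ≤ n₁ ∧ y ≤ n₁, ⟨fun x y hxy => ⟨hxy.1.symm, hxy.2.2, hxy.2.1⟩⟩,
      ⟨fun x hx => hx.1.ne rfl⟩⟩, fun x => if x ≤ n₁ then T.2 x else 0⟩,
    ⟨⟨fun x y => T.1.Adj (n₁ + n₂ + 1 - x) (n₁ + n₂ + 1 - y) ∧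
        (0 ≤ x ∧ x ≤ n₂) ∧ (0 ≤ y ∧ y ≤ n₂), ⟨fun x y hxy => ⟨hxy.1.symm, hxy.2.2, hxy.2.1⟩⟩,
      ⟨fun x hx => hx.1.ne rfl⟩⟩,
      fun x => if 0 ≤ x ∧ x ≤ n₂ then T.2 (n₁ + n₂ + 1 - x) else 0⟩,
    ⟨⟨fun x y => T.1.Adj (x + (n₁ + n₂ + 1)) (y + (n₁ + n₂ + 1)) ∧ 0 ≤ x ∧ 0 ≤ y,
      ⟨fun x y hxy => ⟨hxy.1.symm, hxy.2.2, hxy.2.1⟩⟩, ⟨fun x hx => hx.1.ne rfl⟩⟩,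
      fun x => if 0 ≤ x then T.2 (x + (n₁ + n₂ + 1)) else 0⟩, ?_, ?_, ?_, ?_⟩
  · constructor
    · intro x y hxy
      exact ⟨(supp hxy.1).1, hxy.2.1⟩
    · intro x hx hx'
      simpa [hx'] using (lpos x hx (by omega)).1
    · intro x hx hx'
      simpa [hx'] using (lpos x hx (by omega)).2
    · intro x hx
      simp [h.label_neg x hx]
    · intro x hx
      simp [hx.not_ge]
    · simp [h.label_root]
  · constructor
    · intro x y hxy
      exact hxy.2.1
    · intro x hx hx'
      simpa [hx, hx'] using (lpos (n₁ + n₂ + 1 - x) (by omega) (by omega)).1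
    · intro x hx hx'
      simpa [hx, hx'] using (lpos (n₁ + n₂ + 1 - x) (by omega) (by omega)).2
    · intro x hx
      simp [hx.not_ge]
    · intro x hx
      simp [hx.not_ge]
    · simp
  · constructor
    · intro x y hxy
      have := supp hxy.1
      exact ⟨hxy.2.1, by omega⟩
    · intro x hx hx'
      simpa [hx] using (lpos (x + (n₁ + n₂ + 1)) (by omega) (by omega)).1
    · intro x hx hx'
      simpa [hx] using (lpos (x + (n₁ + n₂ + 1)) (by omega) (by omega)).2
    · intro x hx
      simp [hx.not_ge]
    · intro x hx
      simp [lgt (x + (n₁ + n₂ + 1)) (by omega)]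
    · simp
  · refine Prod.ext ?_ ?_
    · ext x y
      rw [glue_adj]
      simp only [sub_sub_cancel, sub_add_cancel]
      constructor
      · intro hxy
        have := supp hxy
        rcases hcases x y hxy with h' | h' | h' | h'
        · exact Or.inl ⟨hxy, h'⟩
        · exact Or.inr (Or.inl ⟨hxy, by omega, by omega⟩)
        · exact Or.inr (Or.inr (Or.inl ⟨hxy, by omega, by omega⟩))
        · exact Or.inr (Or.inr (Or.inr h'))
      · rintro (h' | h' | h' | ⟨rfl, rfl⟩ | ⟨rfl, rfl⟩)
        · exact h'.1
        · exact h'.1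
        · exact h'.1
        · exact hadj
        · exact hadj.symm
    · funext x
      simp only [glue, sub_sub_cancel, sub_add_cancel]
      split_ifs <;> first | rfl | omega

section glue
variable {k i j j' n₁ n₂ n₃ n₁' n₂' n₃' : ℕ} {s : ℤ} {T₁ T₂ T₃ T₁' T₂' T₃' : LabelledGraph}

lemma glue_root_le (h₁ : IsSupported k i n₁ T₁) (h₂ : IsSupported k j n₂ T₂)
    (h₃ : IsSupported k j n₃ T₃) (h : glue n₁ n₂ T₁ T₂ T₃ = glue n₁' n₂' T₁' T₂' T₃') :
    n₁' + n₂' ≤ n₁ + n₂ := by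
  have hadj : (glue n₁ n₂ T₁ T₂ T₃).1.Adj 0 (n₁' + n₂' + 1) := by
    rw [h]
    exact glue_adj.2 (Or.inr (Or.inr (Or.inr (Or.inl ⟨rfl, rfl⟩))))
  rcases glue_adj_cases h₁ h₂ h₃ hadj with h' | h' | h' | h' | h' <;> omega

lemma glue_left_le (h₁ : IsSupported k i n₁ T₁) (h₂ : IsSupported k j n₂ T₂)
    (h₃ : IsSupported k j n₃ T₃) (h₁' : IsLabelledTree k s i n₁' T₁')
    (hc : n₁' + n₂' = n₁ + n₂) (h : glue n₁ n₂ T₁ T₂ T₃ = glue n₁' n₂' T₁' T₂' T₃') :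
    n₁' ≤ n₁ := by
  by_contra hlt
  obtain ⟨x, y, hxy, -, hx, hy⟩ := exists_adj_of_reachable {x : ℤ | x ≤ n₁}
    (h₁'.conn n₁' (by omega) le_rfl) (by simp) (by simpa using hlt)
  have b := h₁'.supp' hxy
  have hadj : (glue n₁ n₂ T₁ T₂ T₃).1.Adj x y := by
    rw [h]
    exact glue_adj.2 (Or.inl hxy)
  simp only [Set.mem_ofPred_eq] at hx hy
  rcases glue_adj_cases h₁ h₂ h₃ hadj with h' | h' | h' | h' | h' <;> omega

/-- A glued tree determines its parts. -/
lemma glue_injective (h₁ : IsLabelledTree k s i n₁ T₁) (h₂ : IsSupported k j n₂ T₂)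
    (h₃ : IsSupported k j n₃ T₃) (h₁' : IsLabelledTree k s i n₁' T₁')
    (h₂' : IsSupported k j' n₂' T₂') (h₃' : IsSupported k j' n₃' T₃')
    (h : glue n₁ n₂ T₁ T₂ T₃ = glue n₁' n₂' T₁' T₂' T₃') :
    n₁ = n₁' ∧ n₂ = n₂' ∧ j = j' ∧ T₁ = T₁' ∧ T₂ = T₂' ∧ T₃ = T₃' := by
  have s₁ := h₁.toIsSupported
  have s₁' := h₁'.toIsSupported
  have hc := le_antisymm (glue_root_le s₁ h₂ h₃ h) (glue_root_le s₁' h₂' h₃' h.symm)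
  obtain rfl := le_antisymm (glue_left_le s₁' h₂' h₃' h₁ hc.symm h.symm)
    (glue_left_le s₁ h₂ h₃ h₁' hc h)
  obtain rfl : n₂ = n₂' := by omega
  have e₂ (x : ℤ) : T₂.2 x = T₂'.2 x := by
    rcases lt_or_ge x 0 with hx | hx
    · rw [h₂.label_neg x hx, h₂'.label_neg x hx]
    rcases lt_or_ge (n₂ : ℤ) x with hx' | hx'
    · rw [h₂.label_gt x hx', h₂'.label_gt x hx']
    have := congrFun (congrArg Prod.snd h) (n₁ + n₂ + 1 - x)
    rw [glue_label₂ (by omega) (by omega), glue_label₂ (by omega) (by omega)] at this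
    simpa using this
  refine ⟨rfl, rfl, by rw [← h₂.label_root, e₂, h₂'.label_root], ?_, ?_, ?_⟩ <;>
    refine Prod.ext ?_ ?_
  · ext x y
    rw [adj_glue₁ s₁ h₂ h₃, h, ← adj_glue₁ s₁' h₂' h₃']
  · funext x
    rcases lt_or_ge (n₁ : ℤ) x with hx | hx
    · rw [h₁.label_gt x hx, h₁'.label_gt x hx]
    · have := congrFun (congrArg Prod.snd h) x
      rwa [glue_label₁ hx, glue_label₁ hx] at this
  · ext x y
    rw [adj_glue₂ s₁ h₂ h₃, h, ← adj_glue₂ s₁' h₂' h₃']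
  · exact funext e₂
  · ext x y
    rw [adj_glue₃ s₁ h₂ h₃, h, ← adj_glue₃ s₁' h₂' h₃']
  · funext x
    rcases lt_or_ge x 0 with hx | hx
    · rw [h₃.label_neg x hx, h₃'.label_neg x hx]
    · have := congrFun (congrArg Prod.snd h) (x + (n₁ + n₂ + 1))
      rw [glue_label₃ h₂ h₃ (by omega), glue_label₃ h₂' h₃' (by omega)] at this
      simpa using this

end glue

/-! ### Weighted counts and generating functions -/

lemma finite_isSupported (k i n : ℕ) : {T | IsSupported k i n T}.Finite := by
  let f : LabelledGraph → Set (ℤ × ℤ) × Set (ℤ × ℕ) := fun T =>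
    ({p | T.1.Adj p.1 p.2}, {p | p.1 ∈ Set.Icc (0 : ℤ) n ∧ T.2 p.1 = p.2})
  refine Set.Finite.of_finite_image (f := f) ?_ ?_
  · refine (((Set.finite_Icc (0 : ℤ) n).prod (Set.finite_Icc (0 : ℤ) n)).finite_subsets.prod
      ((Set.finite_Icc (0 : ℤ) n).prod (Set.finite_Iic k)).finite_subsets).subset ?_
    rintro _ ⟨T, hT : IsSupported k i n T, rfl⟩
    refine ⟨fun p hp => ?_, fun p hp => ⟨hp.1, ?_⟩⟩
    · have := hT.supp' hp
      exact ⟨⟨this.1, this.2.1⟩, ⟨this.2.2.1, this.2.2.2⟩⟩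
    · have := hT.label_le p.1 hp.1.1 hp.1.2
      rwa [hp.2] at this
  · intro T (hT : IsSupported k i n T) T' (hT' : IsSupported k i n T') h
    simp only [f, Prod.mk.injEq] at h
    refine Prod.ext ?_ ?_
    · ext x y
      exact Set.ext_iff.1 h.1 (x, y)
    · funext x
      rcases lt_or_ge x 0 with hx | hx
      · rw [hT.label_neg x hx, hT'.label_neg x hx]
      rcases lt_or_ge (n : ℤ) x with hx' | hx'
      · rw [hT.label_gt x hx', hT'.label_gt x hx']
      · exact (((Set.ext_iff.1 h.2 (x, T.2 x)).1 ⟨⟨hx, hx'⟩, rfl⟩).2).symm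

/-- The finite set of labelled trees on `[0, n]` with root label `i`. -/
noncomputable def labelledTrees (k : ℕ) (s : ℤ) (i n : ℕ) : Finset LabelledGraph :=
  (Set.Finite.subset (t := {T | IsLabelledTree k s i n T}) (finite_isSupported k i n)
    (fun _ h => IsLabelledTree.toIsSupported h)).toFinset

lemma mem_labelledTrees {k i n : ℕ} {s : ℤ} {T : LabelledGraph} :
    T ∈ labelledTrees k s i n ↔ IsLabelledTree k s i n T := by
  rw [labelledTrees, Set.Finite.mem_toFinset]
  rfl

section weight
variable {R : Type*} [CommRing R] (y : ℕ → R)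

/-- The weight of a labelled tree: the product of the weights of all labels but that of the
root. -/
noncomputable def treeWeight (n : ℕ) (T : LabelledGraph) : R :=
  ∏ x ∈ Finset.Ioc (0 : ℤ) n, y (T.2 x)

/-- The total weight of all labelled trees on `[0, n]` with root label `i`. -/
noncomputable def totalWeight (k : ℕ) (s : ℤ) (i n : ℕ) : R :=
  ∑ T ∈ labelledTrees k s i n, treeWeight y n T

lemma treeWeight_glue {k j n₁ n₂ n₃ : ℕ} {T₁ T₂ T₃ : LabelledGraph}
    (h₂ : IsSupported k j n₂ T₂) (h₃ : IsSupported k j n₃ T₃) :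
    treeWeight y (n₁ + n₂ + n₃ + 1) (glue n₁ n₂ T₁ T₂ T₃) =
      y j * treeWeight y n₁ T₁ * treeWeight y n₂ T₂ * treeWeight y n₃ T₃ := by
  have hsplit : Finset.Ioc (0 : ℤ) ((n₁ + n₂ + n₃ + 1 : ℕ) : ℤ) =
      insert (n₁ + n₂ + 1 : ℤ) (Finset.Ioc (0 : ℤ) n₁ ∪ (Finset.Ico (n₁ + 1 : ℤ) (n₁ + n₂ + 1) ∪
        Finset.Ioc (n₁ + n₂ + 1 : ℤ) (n₁ + n₂ + 1 + n₃))) := by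
    ext x
    simp only [Finset.mem_Ioc, Finset.mem_insert, Finset.mem_union, Finset.mem_Ico]
    omega
  rw [treeWeight, hsplit, Finset.prod_insert (by simp), Finset.prod_union, Finset.prod_union,
    glue_label₃ h₂ h₃ le_rfl, sub_self, h₃.label_root]
  · simp only [mul_assoc]
    congr 2
    · refine Finset.prod_congr rfl fun x hx => ?_
      rw [glue_label₁ (Finset.mem_Ioc.1 hx).2]
    congr 1
    · refine Finset.prod_nbij' (fun x => n₁ + n₂ + 1 - x) (fun x => n₁ + n₂ + 1 - x) ?_ ?_ ?_ ?_ ?_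
      · simp only [Finset.mem_Ioc, Finset.mem_Ico]; omega
      · simp only [Finset.mem_Ioc, Finset.mem_Ico]; omega
      · simp
      · simp
      · intro x hx
        rw [Finset.mem_Ico] at hx
        rw [glue_label₂ (by omega) (by omega)]
    · refine Finset.prod_nbij' (fun x => x - (n₁ + n₂ + 1)) (fun x => x + (n₁ + n₂ + 1)) ?_ ?_ ?_
        ?_ ?_
      · simp only [Finset.mem_Ioc]; omega
      · simp only [Finset.mem_Ioc]; omega
      · simp
      · simp
      · intro x hx
        rw [Finset.mem_Ioc] at hx
        rw [glue_label₃ h₂ h₃ hx.1.le]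
  · rw [Finset.disjoint_left]
    simp only [Finset.mem_Ioc, Finset.mem_Ico]; omega
  · rw [Finset.disjoint_left]
    simp only [Finset.mem_Ioc, Finset.mem_Ico, Finset.mem_union]; omega

lemma totalWeight_zero {k i : ℕ} (s : ℤ) (hi : 1 ≤ i) (hik : i ≤ k) :
    totalWeight y k s i 0 = 1 := by
  have : labelledTrees k s i 0 = {(⊥, fun x => if x = 0 then i else 0)} := by
    ext T
    rw [mem_labelledTrees, Finset.mem_singleton]
    constructor
    · intro h
      refine Prod.ext ?_ ?_
      · ext x y
        simp only [SimpleGraph.bot_adj, iff_false]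
        intro hxy
        have := h.toIsSupported.supp' hxy
        exact hxy.ne (by push_cast at this; omega)
      · funext x
        rcases lt_trichotomy x 0 with hx | rfl | hx
        · simp [h.label_neg x hx, hx.ne]
        · simp [h.label_root]
        · simp [h.label_gt x (by simpa using hx), hx.ne']
    · rintro rfl
      constructor
      · constructor
        · simp
        · intro x hx hx'
          obtain rfl : x = 0 := by push_cast at hx'; omega
          simpa
        · intro x hx hx'
          obtain rfl : x = 0 := by push_cast at hx'; omega
          simpa
        · intro x hx
          simp [hx.ne]
        · intro x hx
          have : x ≠ 0 := by push_cast at hx; omega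
          simp [this]
        · simp
      · intro x hx hx'
        obtain rfl : x = 0 := by push_cast at hx'; omega
        exact .refl _
      · simp
      · simp
      · simp
  simp [totalWeight, this, treeWeight]

/-- The recursion for the total weights that comes from gluing. -/
lemma totalWeight_succ (k : ℕ) (s : ℤ) (i N : ℕ) :
    totalWeight y k s i (N + 1) =
      ∑ q ∈ Finset.HasAntidiagonal.antidiagonal N, ∑ p ∈ Finset.HasAntidiagonal.antidiagonal q.1,
        ∑ j ∈ (Finset.Icc 1 k).filter (fun j => 0 < s → i + j ≤ k + 1),
          y j * totalWeight y k s i p.1 * totalWeight y k (-s) j p.2 * totalWeight y k s j q.2 := by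
  have hR : ∀ q ∈ Finset.HasAntidiagonal.antidiagonal N,
      ∀ p ∈ Finset.HasAntidiagonal.antidiagonal q.1,
      ∀ j ∈ (Finset.Icc 1 k).filter (fun j => 0 < s → i + j ≤ k + 1),
      y j * totalWeight y k s i p.1 * totalWeight y k (-s) j p.2 * totalWeight y k s j q.2 =
        ∑ t ∈ labelledTrees k s i p.1 ×ˢ labelledTrees k (-s) j p.2 ×ˢ labelledTrees k s j q.2,
          y j * treeWeight y p.1 t.1 * treeWeight y p.2 t.2.1 * treeWeight y q.2 t.2.2 := by
    intro q _ p _ j _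
    simp only [totalWeight, Finset.sum_product, mul_assoc, ← Finset.mul_sum, ← Finset.sum_mul]
  rw [Finset.sum_congr rfl fun q hq => Finset.sum_congr rfl fun p hp =>
    Finset.sum_congr rfl (hR q hq p hp)]
  simp only [Finset.sum_sigma']
  symm
  refine Finset.sum_bij
    (fun a _ => glue a.2.1.1 a.2.1.2 a.2.2.2.1 a.2.2.2.2.1 a.2.2.2.2.2) ?_ ?_ ?_ ?_
  · rintro ⟨⟨q₁, q₂⟩, ⟨p₁, p₂⟩, j, T₁, T₂, T₃⟩ ha
    simp only [Finset.mem_sigma, Finset.HasAntidiagonal.mem_antidiagonal, Finset.mem_filter,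
      Finset.mem_product, mem_labelledTrees] at ha ⊢
    obtain ⟨rfl, rfl, hj, t₁, t₂, t₃⟩ := ha
    exact (isLabelledTree_glue_iff t₁.toIsSupported t₂.toIsSupported t₃.toIsSupported).2
      ⟨t₁, t₂, t₃, hj.2⟩
  · rintro ⟨⟨q₁, q₂⟩, ⟨p₁, p₂⟩, j, T₁, T₂, T₃⟩ ha ⟨⟨q₁', q₂'⟩, ⟨p₁', p₂'⟩, j', T₁', T₂', T₃'⟩ ha' hg
    simp only [Finset.mem_sigma, Finset.HasAntidiagonal.mem_antidiagonal, Finset.mem_filter,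
      Finset.mem_product, mem_labelledTrees] at ha ha' hg
    obtain ⟨rfl, rfl, hj, t₁, t₂, t₃⟩ := ha
    obtain ⟨hq', rfl, hj', t₁', t₂', t₃'⟩ := ha'
    obtain ⟨rfl, rfl, rfl, rfl, rfl, rfl⟩ := glue_injective t₁ t₂.toIsSupported t₃.toIsSupported
      t₁' t₂'.toIsSupported t₃'.toIsSupported hg
    obtain rfl : q₂ = q₂' := by omega
    rfl
  · intro T hT
    rw [mem_labelledTrees] at hT
    obtain ⟨n₁, n₂, n₃, j, rfl, hj, hjk, T₁, T₂, T₃, h₁, h₂, h₃, rfl⟩ := hT.exists_glue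
    rw [isLabelledTree_glue_iff h₁ h₂ h₃] at hT
    refine ⟨⟨⟨n₁ + n₂, n₃⟩, ⟨n₁, n₂⟩, j, T₁, T₂, T₃⟩, ?_, rfl⟩
    simp only [Finset.mem_sigma, Finset.HasAntidiagonal.mem_antidiagonal, Finset.mem_filter,
      Finset.mem_product, mem_labelledTrees, Finset.mem_Icc]
    exact ⟨trivial, trivial, ⟨⟨hj, hjk⟩, hT.2.2.2⟩, hT.1, hT.2.1, hT.2.2.1⟩
  · rintro ⟨⟨q₁, q₂⟩, ⟨p₁, p₂⟩, j, T₁, T₂, T₃⟩ ha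
    simp only [Finset.mem_sigma, Finset.HasAntidiagonal.mem_antidiagonal, Finset.mem_filter,
      Finset.mem_product, mem_labelledTrees] at ha ⊢
    obtain ⟨rfl, rfl, hj, t₁, t₂, t₃⟩ := ha
    exact (treeWeight_glue y t₂.toIsSupported t₃.toIsSupported).symm

/-- The generating function of labelled trees with root label `i`, by the number of edges. -/
noncomputable def treeSeries (k : ℕ) (s : ℤ) (i : ℕ) : PowerSeries R :=
  PowerSeries.mk fun n => totalWeight y k s i n

lemma treeSeries_eq {k i : ℕ} (s : ℤ) (hi : 1 ≤ i) (hik : i ≤ k) :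
    treeSeries y k s i = 1 + PowerSeries.X * (treeSeries y k s i *
      ∑ j ∈ (Finset.Icc 1 k).filter (fun j => 0 < s → i + j ≤ k + 1),
        PowerSeries.C (y j) * treeSeries y k (-s) j * treeSeries y k s j) := by
  ext n
  cases n with
  | zero => simp [treeSeries, totalWeight_zero y s hi hik]
  | succ N =>
    rw [map_add, PowerSeries.coeff_succ_X_mul, PowerSeries.coeff_one, if_neg N.succ_ne_zero,
      zero_add, Finset.mul_sum, map_sum,
      show PowerSeries.coeff (N + 1) (treeSeries y k s i) = totalWeight y k s i (N + 1) from
        PowerSeries.coeff_mk _ _, totalWeight_succ]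
    have (j : ℕ) : PowerSeries.coeff N (treeSeries y k s i *
        (PowerSeries.C (y j) * treeSeries y k (-s) j * treeSeries y k s j)) =
        ∑ q ∈ Finset.HasAntidiagonal.antidiagonal N, ∑ p ∈ Finset.HasAntidiagonal.antidiagonal q.1,
          y j * totalWeight y k s i p.1 * totalWeight y k (-s) j p.2 * totalWeight y k s j q.2 := by
      rw [show treeSeries y k s i *
        (PowerSeries.C (y j) * treeSeries y k (-s) j * treeSeries y k s j) =
        PowerSeries.C (y j) * ((treeSeries y k s i * treeSeries y k (-s) j) *
          treeSeries y k s j) by ring]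
      rw [PowerSeries.coeff_C_mul, PowerSeries.coeff_mul, Finset.mul_sum]
      refine Finset.sum_congr rfl fun q _ => ?_
      rw [PowerSeries.coeff_mul, Finset.sum_mul, Finset.mul_sum]
      refine Finset.sum_congr rfl fun p _ => ?_
      simp only [treeSeries, PowerSeries.coeff_mk]
      ring
    simp only [this]
    rw [Finset.sum_comm]
    refine Finset.sum_congr rfl fun q _ => ?_
    rw [Finset.sum_comm]

end weight

/-! ### From trees on `Fin n` to trees on integer intervals -/

/-- In a tree, the endpoint `i` of an edge `ij` lies on the path from the root to `j` precisely if
it is still reachable from the root when the edge is removed. -/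
lemma onRootPath_iff {N : ℕ} {G : SimpleGraph (Fin (N + 1))} (hG : G.IsTree) {i j : Fin (N + 1)}
    (hij : G.Adj i j) : OnRootPath G i j ↔ (cutEdge G i j).Reachable 0 i := by
  constructor
  · rintro ⟨r, p, hr, hp, hi⟩
    obtain rfl : r = 0 := Fin.ext hr
    refine ⟨(p.takeUntil i hi).toDeleteEdges {s(i, j)} fun e he h => ?_⟩
    rw [Set.mem_singleton_iff] at h
    subst h
    exact SimpleGraph.Walk.endpoint_notMem_support_takeUntil hp hi hij.ne'
      (SimpleGraph.Walk.snd_mem_support_of_mem_edges _ he)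
  · intro h
    obtain ⟨q, hq⟩ := h.exists_isPath
    have hj : j ∉ q.support := by
      intro hj
      have hbr : ¬ (cutEdge G i j).Reachable i j :=
        SimpleGraph.isBridge_iff.1 
          (SimpleGraph.isAcyclic_iff_forall_adj_isBridge.1 hG.isAcyclic hij)
      exact hbr (h.symm.trans (q.takeUntil j hj).reachable)
    have hle := cutEdge_le G i j
    have hj' : j ∉ (q.mapLe hle).support := by simpa using hj
    refine ⟨0, (q.mapLe hle).concat hij, rfl, (hq.mapLe hle).concat hj' hij, ?_⟩
    simp [SimpleGraph.Walk.support_concat]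

/-- A labelled graph on `Fin (N + 1)` as a labelled graph on `ℤ`, living on `[0, N]`. -/
noncomputable def toLabelledGraph {k N : ℕ}
    (T : SimpleGraph (Fin (N + 1)) × (Fin (N + 1) → Finset.Icc 1 k)) : LabelledGraph :=
  (T.1.map (fun v : Fin (N + 1) => ((v : ℕ) : ℤ)),
    fun x => if h : 0 ≤ x ∧ x ≤ N then (T.2 ⟨x.toNat, by omega⟩ : ℕ) else 0)

section transport
variable {k N : ℕ} {T : SimpleGraph (Fin (N + 1)) × (Fin (N + 1) → Finset.Icc 1 k)}

lemma toLabelledGraph_adj {x y : ℤ} : (toLabelledGraph T).1.Adj x y ↔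
    ∃ u v : Fin (N + 1), T.1.Adj u v ∧ (u : ℤ) = x ∧ (v : ℤ) = y := by
  simp only [toLabelledGraph, SimpleGraph.map_adj']
  refine ⟨fun h => h.2, ?_⟩
  rintro ⟨u, v, h, rfl, rfl⟩
  exact ⟨fun e => h.ne (Fin.ext (by exact_mod_cast e)), u, v, h, rfl, rfl⟩

lemma toLabelledGraph_adj_coe {u v : Fin (N + 1)} :
    (toLabelledGraph T).1.Adj u v ↔ T.1.Adj u v := by
  rw [toLabelledGraph_adj]
  constructor
  · rintro ⟨u', v', h, hu, hv⟩
    obtain rfl : u' = u := Fin.ext (by exact_mod_cast hu)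
    obtain rfl : v' = v := Fin.ext (by exact_mod_cast hv)
    exact h
  · exact fun h => ⟨u, v, h, rfl, rfl⟩

lemma toLabelledGraph_label (v : Fin (N + 1)) : (toLabelledGraph T).2 v = T.2 v := by
  have h : (0 : ℤ) ≤ v ∧ (v : ℤ) ≤ N := ⟨by omega, by omega⟩
  simp [toLabelledGraph, h]

lemma cutEdge_toLabelledGraph_reachable {a b u v : Fin (N + 1)} :
    (cutEdge (toLabelledGraph T).1 a b).Reachable u v ↔ (cutEdge T.1 a b).Reachable u v := by
  constructor
  · intro h
    have := reachable_map (H := cutEdge T.1 a b)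
      (fun x : ℤ => (⟨min x.toNat N, by omega⟩ : Fin (N + 1))) (fun x y hxy => ?_) h
    · convert this using 1 <;> ext <;> simp <;> omega
    · rw [cutEdge_adj, toLabelledGraph_adj] at hxy
      obtain ⟨⟨u', v', hadj, rfl, rfl⟩, hne⟩ := hxy
      have e (w : Fin (N + 1)) : (⟨min (w : ℤ).toNat N, by omega⟩ : Fin (N + 1)) = w := by
        ext; simp; omega
      rw [e, e]
      refine SimpleGraph.Adj.reachable (cutEdge_adj.2 ⟨hadj, fun hc => hne ?_⟩)
      rcases hc with ⟨rfl, rfl⟩ | ⟨rfl, rfl⟩ <;> simp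
  · refine reachable_map (fun w : Fin (N + 1) => (w : ℤ)) fun x y hxy => ?_
    rw [cutEdge_adj] at hxy
    refine SimpleGraph.Adj.reachable
      (cutEdge_adj.2 ⟨toLabelledGraph_adj_coe.2 hxy.1, fun hc => hxy.2 ?_⟩)
    simpa [Fin.ext_iff] using hc

lemma isSupported_toLabelledGraph : IsSupported k (T.2 0) N (toLabelledGraph T) := by
  constructor
  · intro x y hxy
    obtain ⟨u, v, -, rfl, rfl⟩ := toLabelledGraph_adj.1 hxy
    omega
  · intro x hx hx'
    simp only [toLabelledGraph, hx, hx', and_self, dite_true]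
    exact (Finset.mem_Icc.1 (T.2 _).2).1
  · intro x hx hx'
    simp only [toLabelledGraph, hx, hx', and_self, dite_true]
    exact (Finset.mem_Icc.1 (T.2 _).2).2
  · intro x hx
    simp [toLabelledGraph, hx.not_ge]
  · intro x hx
    simp [toLabelledGraph, hx.not_ge]
  · exact toLabelledGraph_label 0

lemma exists_fin_of_le {x : ℤ} (hx : 0 ≤ x) (hx' : x ≤ N) : ∃ v : Fin (N + 1), (v : ℤ) = x :=
  ⟨⟨x.toNat, by omega⟩, by simp [hx]⟩

lemma isKNoncrossingTree_iff :
    IsKNoncrossingTree k T.1 T.2 ↔ IsLabelledTree k 1 (T.2 0) N (toLabelledGraph T) := by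
  have hreach {u v : Fin (N + 1)} :
      (toLabelledGraph T).1.Reachable u v ↔ T.1.Reachable u v := by
    have := cutEdge_toLabelledGraph_reachable (T := T) (a := 0) (b := 0) (u := u) (v := v)
    rwa [cutEdge_self, cutEdge_self] at this
  constructor
  · rintro ⟨⟨htree, hnc⟩, hlab⟩
    refine ⟨isSupported_toLabelledGraph, ?_, ?_, ?_, ?_⟩
    · intro x hx hx'
      obtain ⟨v, rfl⟩ := exists_fin_of_le hx hx'
      exact hreach.2 (htree.connected.preconnected 0 v)
    · intro x y hxy
      obtain ⟨u, v, huv, rfl, rfl⟩ := toLabelledGraph_adj.1 hxy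
      rw [cutEdge_toLabelledGraph_reachable]
      exact SimpleGraph.isBridge_iff.1
        (SimpleGraph.isAcyclic_iff_forall_adj_isBridge.1 htree.isAcyclic huv)
    · intro a b c d hab hbc hcd ⟨hac, hbd⟩
      obtain ⟨a, c, hac', rfl, rfl⟩ := toLabelledGraph_adj.1 hac
      obtain ⟨b, d, hbd', rfl, rfl⟩ := toLabelledGraph_adj.1 hbd
      exact hnc a b c d (by omega) (by omega) (by omega) ⟨hac', hbd'⟩
    · intro x y hxy hlt hr
      obtain ⟨u, v, huv, rfl, rfl⟩ := toLabelledGraph_adj.1 hxy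
      rw [toLabelledGraph_label, toLabelledGraph_label]
      refine hlab u v (by omega) huv ((onRootPath_iff htree huv).2 ?_)
      exact cutEdge_toLabelledGraph_reachable.1 hr
  · intro h
    have hac : T.1.IsAcyclic := by
      rw [SimpleGraph.isAcyclic_iff_forall_adj_isBridge]
      intro u v huv
      rw [SimpleGraph.isBridge_iff]
      exact fun hr => h.bridge u v (toLabelledGraph_adj_coe.2 huv)
        (cutEdge_toLabelledGraph_reachable.2 hr)
    have hconn : ∀ v, T.1.Reachable 0 v := fun v => hreach.1 (h.conn v (by omega) (by omega))
    have htree : T.1.IsTree :=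
      ⟨⟨fun u v => (hconn u).symm.trans (hconn v)⟩, hac⟩
    refine ⟨⟨htree, fun a b c d hab hbc hcd hh => ?_⟩, fun u v huv hadj hr => ?_⟩
    · exact h.noncrossing a b c d (by omega) (by omega) (by omega)
        ⟨toLabelledGraph_adj_coe.2 hh.1, toLabelledGraph_adj_coe.2 hh.2⟩
    · have := h.label_add u v (toLabelledGraph_adj_coe.2 hadj) (by omega)
        (cutEdge_toLabelledGraph_reachable.2 ((onRootPath_iff htree hadj).1 hr))
      rwa [toLabelledGraph_label, toLabelledGraph_label] at this

end transport

lemma toLabelledGraph_injective {k N : ℕ} :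
    Function.Injective (toLabelledGraph (k := k) (N := N)) := by
  intro T T' h
  refine Prod.ext ?_ ?_
  · ext u v
    rw [← toLabelledGraph_adj_coe, h, toLabelledGraph_adj_coe]
  · funext v
    ext
    rw [← toLabelledGraph_label, h, toLabelledGraph_label]

/-- Every labelled graph that lives on `[0, N]` comes from one on `Fin (N + 1)`. -/
lemma IsSupported.exists_toLabelledGraph {k i N : ℕ} {T : LabelledGraph}
    (h : IsSupported k i N T) : ∃ T', toLabelledGraph (k := k) (N := N) T' = T := by
  refine ⟨(T.1.comap (fun v : Fin (N + 1) => (v : ℤ)), fun v => ⟨T.2 v, Finset.mem_Icc.2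
    ⟨h.label_pos v (by omega) (by omega), h.label_le v (by omega) (by omega)⟩⟩), ?_⟩
  refine Prod.ext ?_ ?_
  · ext x y
    rw [toLabelledGraph_adj]
    constructor
    · rintro ⟨u, v, huv, rfl, rfl⟩
      exact huv
    · intro hxy
      have b := h.supp' hxy
      obtain ⟨u, rfl⟩ := exists_fin_of_le b.1 b.2.1
      obtain ⟨v, rfl⟩ := exists_fin_of_le b.2.2.1 b.2.2.2
      exact ⟨u, v, hxy, rfl, rfl⟩
  · funext x
    by_cases hx : 0 ≤ x ∧ x ≤ N
    · simp [toLabelledGraph, hx]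
    · simp only [toLabelledGraph, hx, dite_false]
      rcases not_and_or.1 hx with hx | hx
      · exact (h.label_neg x (not_le.1 hx)).symm
      · exact (h.label_gt x (not_le.1 hx)).symm

/-- The weighted count of `k`-noncrossing trees in terms of the total weights by root label. -/
lemma sum_prod_kNoncrossingTrees {R : Type*} [CommRing R] (y : ℕ → R) (k N : ℕ) :
    ∑ T ∈ kNoncrossingTrees k (N + 1), ∏ v, y (T.2 v) =
      ∑ i ∈ Finset.Icc 1 k, y i * totalWeight y k 1 i N := by
  simp only [totalWeight, Finset.mul_sum]
  rw [Finset.sum_sigma']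
  refine Finset.sum_bij (fun T _ => ⟨T.2 0, toLabelledGraph T⟩) ?_ ?_ ?_ ?_
  · intro T hT
    simp only [kNoncrossingTrees, Finset.mem_filter, Finset.mem_univ, true_and] at hT
    rw [Finset.mem_sigma, mem_labelledTrees]
    exact ⟨(T.2 0).2, isKNoncrossingTree_iff.1 hT⟩
  · intro T _ T' _ h
    simp only [Sigma.mk.injEq, heq_eq_eq] at h
    exact toLabelledGraph_injective h.2
  · rintro ⟨i, T⟩ h
    rw [Finset.mem_sigma, mem_labelledTrees] at h
    obtain ⟨T, rfl⟩ := h.2.toIsSupported.exists_toLabelledGraph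
    have hi : (T.2 0 : ℕ) = i := by
      rw [← toLabelledGraph_label]
      exact h.2.label_root
    subst hi
    exact ⟨T, by simpa [kNoncrossingTrees] using isKNoncrossingTree_iff.2 h.2, rfl⟩
  · intro T _
    rw [Fin.prod_univ_succ, treeWeight]
    congr 1
    refine Finset.prod_bij (fun v _ => ((v.succ : Fin (N + 1)) : ℤ)) ?_ ?_ ?_ ?_
    · intro v _
      simp only [Finset.mem_Ioc, Fin.val_succ]
      omega
    · intro v _ v' _ h
      ext
      simpa using h
    · intro x hx
      rw [Finset.mem_Ioc] at hx
      exact ⟨⟨(x - 1).toNat, by omega⟩, Finset.mem_univ _, by simp; omega⟩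
    · intro v _
      rw [toLabelledGraph_label]

/-! ### The functional equations and their solution -/

section functional
variable {R : Type*} [CommRing R] (y : ℕ → R)

/-- The mirrored trees, in which the root may have any children, are counted like the trees whose
root has label `1`. -/
lemma treeSeries_neg_one {k i : ℕ} (hi : 1 ≤ i) (hik : i ≤ k) :
    treeSeries y k (-1) i = treeSeries y k 1 1 := by
  have h₁ := treeSeries_eq y (-1) hi hik
  have h₂ := treeSeries_eq y 1 le_rfl (hi.trans hik)
  rw [Finset.filter_true_of_mem (by simp)] at h₁
  rw [Finset.filter_true_of_mem (by simp only [Finset.mem_Icc]; omega)] at h₂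
  rw [neg_neg] at h₁
  have h₃ : ∑ j ∈ Finset.Icc 1 k, PowerSeries.C (y j) * treeSeries y k 1 j * treeSeries y k (-1) j =
      ∑ j ∈ Finset.Icc 1 k, PowerSeries.C (y j) * treeSeries y k (-1) j * treeSeries y k 1 j :=
    Finset.sum_congr rfl fun j _ => by ring
  rw [h₃] at h₁
  refine left_inv_eq_right_inv (a := 1 - PowerSeries.X * ∑ j ∈ Finset.Icc 1 k,
    PowerSeries.C (y j) * treeSeries y k (-1) j * treeSeries y k 1 j) ?_ ?_
  · linear_combination h₁
  · linear_combination h₂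

lemma treeSeries_one {k i : ℕ} (hi : 1 ≤ i) (hik : i ≤ k) :
    treeSeries y k 1 i = 1 + PowerSeries.X * (treeSeries y k 1 i * treeSeries y k 1 1 *
      ∑ j ∈ Finset.Icc 1 (k + 1 - i), PowerSeries.C (y j) * treeSeries y k 1 j) := by
  conv_lhs => rw [treeSeries_eq y 1 hi hik]
  rw [show (Finset.Icc 1 k).filter (fun j => (0 : ℤ) < 1 → i + j ≤ k + 1) =
    Finset.Icc 1 (k + 1 - i) by
      ext j
      simp only [Finset.mem_filter, Finset.mem_Icc, zero_lt_one, true_imp_iff]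
      omega]
  rw [mul_assoc (treeSeries y k 1 i), Finset.mul_sum _ _ (treeSeries y k 1 1)]
  congr 3
  refine Finset.sum_congr rfl fun j hj => ?_
  rw [Finset.mem_Icc] at hj
  rw [treeSeries_neg_one y hj.1 (by omega)]
  ring

end functional

section system
variable {P : Type*} [CommRing P]

/-- The solution of the system of functional equations: the unknowns are powers of the last one,
which satisfies the equation of the Fuss–Catalan series. The product `a i * a (k + 1 - i)` does not
depend on `i`. -/
lemma system_solution {k : ℕ} (hk : 1 ≤ k) (x : P) (a : ℕ → P)
    (h : ∀ i, 1 ≤ i → i ≤ k →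
      a i = 1 + x * (a i * a 1 * ∑ j ∈ Finset.Icc 1 (k + 1 - i), a j)) :
    (∀ i, 1 ≤ i → i ≤ k → a i = a k ^ (k + 1 - i)) ∧ a k = 1 + x * a k ^ (2 * k + 1) := by
  have hdiff (i : ℕ) (hi : 1 ≤ i) (hik : i + 1 ≤ k) :
      a i - a (i + 1) = x * a 1 * a i * a (i + 1) * a (k + 1 - i) := by
    have h₁ := h i hi (by omega)
    have h₂ := h (i + 1) (by omega) hik
    rw [show k + 1 - i = (k - i) + 1 by omega, Finset.sum_Icc_succ_top (by omega)] at h₁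
    rw [show k + 1 - (i + 1) = k - i by omega] at h₂
    rw [show k + 1 - i = (k - i) + 1 by omega]
    linear_combination a (i + 1) * h₁ - a i * h₂
  have hq (i : ℕ) (hi : 1 ≤ i) : i ≤ k → a i * a (k + 1 - i) = a 1 * a k := by
    induction i, hi using Nat.le_induction with
    | base => simp
    | succ i hi ih =>
      intro hik
      rw [← ih (by omega)]
      have h₁ := hdiff i hi hik
      have h₂ := hdiff (k - i) (by omega) (by omega)
      rw [show k - i + 1 = k + 1 - i by omega, show k + 1 - (k - i) = i + 1 by omega] at h₂
      rw [show k + 1 - (i + 1) = k - i by omega]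
      linear_combination -a (k - i) * h₁ + a i * h₂
  have hlast : a k = 1 + x * a 1 * (a 1 * a k) := by
    have := h k hk le_rfl
    rw [show k + 1 - k = 1 by omega] at this
    simp only [Finset.Icc_self, Finset.sum_singleton] at this
    linear_combination this
  have hpow (t : ℕ) : t + 1 ≤ k → a (k - t) = a k ^ (t + 1) := by
    induction t with
    | zero => simp
    | succ t ih =>
      intro ht
      have h₁ := hdiff (k - (t + 1)) (by omega) (by omega)
      have h₂ := hq (k - (t + 1)) (by omega) (by omega)
      rw [show k - (t + 1) + 1 = k - t by omega, ih (by omega)] at h₁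
      linear_combination h₁ + x * a 1 * a k ^ (t + 1) * h₂ - a k ^ (t + 1) * hlast
  have hpow' (i : ℕ) (hi : 1 ≤ i) (hik : i ≤ k) : a i = a k ^ (k + 1 - i) := by
    have := hpow (k - i) (by omega)
    rwa [show k - (k - i) = i by omega, show k - i + 1 = k + 1 - i by omega] at this
  refine ⟨hpow', ?_⟩
  have h₁ := hpow' 1 le_rfl hk
  rw [show k + 1 - 1 = k by omega] at h₁
  conv_lhs => rw [hlast, h₁]
  ring

/-- The linear system for the logarithmic derivatives `e i` of the solutions with respect to the
weight of the label `h`. The sums `e b + e (k + 1 - b)` are constant up to jumps at `h` and at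
`k + 1 - h`, so that `e` is piecewise linear; summing its increments determines `e 1`. -/
lemma linear_system_solution {k h : ℕ} (hh : 1 ≤ h) (hhk : h ≤ k) (u v : P) (huv : u * v = 1)
    (e : ℕ → P) (he : e (k + 1) = 0)
    (H : ∀ a ≤ k, v ^ a * e (k + 1 - a) = e 1 * (1 - v ^ a) +
      (u - 1) * ((∑ j ∈ Finset.Icc 1 a, v ^ j * e j) + if h ≤ a then v ^ h else 0)) :
    u * e 1 = (u - 1) * (2 * k * u * e 1 + (u - 1) * (k + 2 - 2 * h) + 1) := by
  have hrec (a b : ℕ) (hab : a + b = k + 1) (ha : 1 ≤ a) (hb : 1 ≤ b) :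
      e b - u * e (b + 1) = (u - 1) * (e 1 + e a + if h = a then 1 else 0) := by
    obtain ⟨a, rfl⟩ : ∃ c, a = c + 1 := ⟨a - 1, by omega⟩
    have h₁ := H (a + 1) (by omega)
    have h₂ := H a (by omega)
    rw [Finset.sum_Icc_succ_top (by omega), show k + 1 - (a + 1) = b by omega] at h₁
    rw [show k + 1 - a = b + 1 by omega] at h₂
    have hpow : u ^ a * v ^ a = 1 := by rw [← mul_pow, huv, one_pow]
    have hpow' : u ^ (a + 1) * v ^ (a + 1) = 1 := by rw [← mul_pow, huv, one_pow]
    have hif : u ^ (a + 1) * ((if h ≤ a + 1 then v ^ h else 0) - if h ≤ a then v ^ h else 0) =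
        if h = a + 1 then 1 else 0 := by
      rcases lt_trichotomy h (a + 1) with hlt | rfl | hgt
      · simp [hlt.le, hlt.ne, Nat.lt_succ_iff.1 hlt]
      · simp [hpow']
      · simp [hgt.ne', hgt.not_ge, show ¬ h ≤ a by omega]
    linear_combination u ^ (a + 1) * (h₁ - h₂) + (u - 1) * hif +
      (-e b - e 1 + (u - 1) * e (a + 1)) * hpow' + (u * e (b + 1) + u * e 1) * hpow
  have hsum (b : ℕ) (hb : 1 ≤ b) : b ≤ k → e b + e (k + 1 - b) = e 1 * (2 * u - 1) +
      (u - 1) * ((if h ≤ b then 1 else 0) - if k + 1 - h < b then 1 else 0) := by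
    induction b, hb using Nat.le_induction with
    | base =>
      intro hk
      have h₁ := hrec 1 k (by omega) le_rfl hk
      rw [he] at h₁
      have e₁ : (if h ≤ 1 then (1 : P) else 0) = if h = 1 then 1 else 0 := by
        congr 1; exact propext (by omega)
      rw [e₁, if_neg (by omega : ¬ k + 1 - h < 1), show k + 1 - 1 = k by omega]
      linear_combination h₁
    | succ b hb ih =>
      intro hbk
      have h₀ := ih (by omega)
      have h₁ := hrec (k + 1 - b) b (by omega) (by omega) hb
      have h₂ := hrec (b + 1) (k - b) (by omega) (by omega) (by omega)
      rw [show k - b + 1 = k + 1 - b by omega] at h₂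
      rw [show k + 1 - (b + 1) = k - b by omega]
      have e₁ : (if h ≤ b + 1 then (1 : P) else 0) =
          (if h ≤ b then 1 else 0) + if h = b + 1 then 1 else 0 := by
        split_ifs <;> first | omega | simp
      have e₂ : (if k + 1 - h < b + 1 then (1 : P) else 0) =
          (if k + 1 - h < b then 1 else 0) + if h = k + 1 - b then 1 else 0 := by
        split_ifs <;> first | omega | simp
      rw [e₁, e₂]
      linear_combination h₀ - h₁ + h₂
  have hstep (b : ℕ) (hb : b ∈ Finset.range k) : u * e (b + 1) - u * e (b + 1 + 1) =
      (u - 1) * (2 * u * e 1 + (u - 1) * ((if h ≤ b + 1 then 1 else 0) -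
        if k + 1 - h < b + 1 then 1 else 0) + if h = k - b then 1 else 0) := by
    rw [Finset.mem_range] at hb
    have h₁ := hrec (k - b) (b + 1) (by omega) (by omega) (by omega)
    have h₂ := hsum (b + 1) (by omega) (by omega)
    rw [show k + 1 - (b + 1) = k - b by omega] at h₂
    linear_combination h₁ + (u - 1) * h₂
  have htel := Finset.sum_range_sub' (fun b => u * e (b + 1)) k
  rw [Finset.sum_congr rfl hstep, he] at htel
  have c₁ : ∑ b ∈ Finset.range k, (if h ≤ b + 1 then (1 : P) else 0) = k + 1 - h := by
    rw [Finset.sum_boole, show (Finset.range k).filter (fun b => h ≤ b + 1) =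
      Finset.Ico (h - 1) k by ext; simp; omega, Nat.card_Ico,
      show k - (h - 1) = k + 1 - h by omega, Nat.cast_sub (by omega)]
    push_cast; ring
  have c₂ : ∑ b ∈ Finset.range k, (if k + 1 - h < b + 1 then (1 : P) else 0) = h - 1 := by
    rw [Finset.sum_boole, show (Finset.range k).filter (fun b => k + 1 - h < b + 1) =
      Finset.Ico (k + 1 - h) k by ext; simp; omega, Nat.card_Ico,
      show k - (k + 1 - h) = h - 1 by omega, Nat.cast_sub hh]
    push_cast; ring
  have c₃ : ∑ b ∈ Finset.range k, (if h = k - b then (1 : P) else 0) = 1 := by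
    rw [Finset.sum_boole, show (Finset.range k).filter (fun b => h = k - b) = {k - h} by
      ext; simp; omega]
    simp
  rw [← Finset.mul_sum, Finset.sum_add_distrib, Finset.sum_add_distrib,
    ← Finset.mul_sum, ← Finset.mul_sum, Finset.sum_sub_distrib, c₁, c₂, c₃,
    Finset.sum_const, Finset.card_range, nsmul_eq_mul] at htel
  simp only [zero_add] at htel
  linear_combination -htel

end system

/-! ### The coefficients of powers of the Fuss–Catalan series -/

/-- The product `(np - r - 1)(np - r - 2) ⋯ (np - r - (n - 1)) / (n - 1)!`, the binomial coefficient
`np - r - 1` over `n - 1`. -/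
noncomputable def fussBinomial (p n : ℕ) (r : ℝ) : ℝ :=
  (∏ j ∈ Finset.range (n - 1), ((n : ℝ) * p - r - 1 - j)) / (n - 1).factorial

/-- The recursion of the Fuss–Catalan numbers `-(r / n) * fussBinomial p n r`. -/
lemma fussBinomial_recurrence (p m : ℕ) (r : ℝ) :
    -r / (m + 2 : ℕ) * fussBinomial p (m + 2) r -
        -(r + 1) / (m + 2 : ℕ) * fussBinomial p (m + 2) (r + 1) =
      -(r + 1 - p) / (m + 1 : ℕ) * fussBinomial p (m + 1) (r + 1 - p) := by
  set Q := ∏ j ∈ Finset.range m, ((m + 2 : ℝ) * p - r - 2 - j) with hQ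
  have e₁ : fussBinomial p (m + 2) r =
      Q * ((m + 2 : ℝ) * p - r - 1) / ((m + 1) * m.factorial) := by
    rw [fussBinomial, show m + 2 - 1 = m + 1 by omega, Finset.prod_range_succ',
      Nat.factorial_succ]
    push_cast
    congr 2
    · exact Finset.prod_congr rfl fun j _ => by ring
    · ring
  have e₂ : fussBinomial p (m + 2) (r + 1) =
      Q * ((m + 2 : ℝ) * p - r - 2 - m) / ((m + 1) * m.factorial) := by
    rw [fussBinomial, show m + 2 - 1 = m + 1 by omega, Finset.prod_range_succ,
      Nat.factorial_succ]
    push_cast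
    congr 2
    · exact Finset.prod_congr rfl fun j _ => by ring
    · ring
  have e₃ : fussBinomial p (m + 1) (r + 1 - p) = Q / m.factorial := by
    rw [fussBinomial, show m + 1 - 1 = m by omega]
    push_cast
    congr 1
    exact Finset.prod_congr rfl fun j _ => by ring
  rw [e₁, e₂, e₃]
  have : (m.factorial : ℝ) ≠ 0 := by positivity
  push_cast
  field_simp
  ring

/-- The coefficients of all integral powers of the series `u` with `u = 1 + X u ^ p`. -/
lemma coeff_zpow_fuss (p : ℕ) (u : (PowerSeries ℝ)ˣ)
    (hu : (u : PowerSeries ℝ) = 1 + PowerSeries.X * (u : PowerSeries ℝ) ^ p) (n : ℕ) :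
    ∀ r : ℤ, PowerSeries.coeff n ((u ^ (-r) : (PowerSeries ℝ)ˣ) : PowerSeries ℝ) =
      if n = 0 then 1 else -r / (n : ℕ) * fussBinomial p n r := by
  have hstep (r : ℤ) : ((u ^ (-r) : (PowerSeries ℝ)ˣ) : PowerSeries ℝ) =
      ((u ^ (-(r + 1)) : (PowerSeries ℝ)ˣ) : PowerSeries ℝ) +
        PowerSeries.X * ((u ^ (-(r + 1 - p)) : (PowerSeries ℝ)ˣ) : PowerSeries ℝ) := by
    have e₁ : u ^ (-r) = u ^ (-(r + 1)) * u := by rw [← zpow_add_one]; congr 1; ring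
    have e₂ : u ^ (-(r + 1 - p)) = u ^ (-(r + 1)) * u ^ p := by
      rw [← zpow_natCast, ← zpow_add]; congr 1; ring
    rw [e₁, e₂, Units.val_mul, Units.val_mul, Units.val_pow_eq_pow_val]
    linear_combination ((u ^ (-(r + 1)) : (PowerSeries ℝ)ˣ) : PowerSeries ℝ) * hu
  induction n with
  | zero =>
    have h0 : PowerSeries.constantCoeff ((u : (PowerSeries ℝ)ˣ) : PowerSeries ℝ) = 1 := by
      rw [hu]; simp
    have hmap : Units.map (PowerSeries.constantCoeff (R := ℝ)).toMonoidHom u = 1 :=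
      Units.ext h0
    intro r
    have := congrArg (fun w : ℝˣ => ((w ^ (-r) : ℝˣ) : ℝ)) hmap
    simp only [one_zpow, Units.val_one, ← map_zpow] at this
    rw [if_pos rfl, PowerSeries.coeff_zero_eq_constantCoeff_apply]
    exact this
  | succ n ih =>
    have hrec (r : ℤ) :
        PowerSeries.coeff (n + 1) ((u ^ (-r) : (PowerSeries ℝ)ˣ) : PowerSeries ℝ) -
          PowerSeries.coeff (n + 1) ((u ^ (-(r + 1)) : (PowerSeries ℝ)ˣ) : PowerSeries ℝ) =
        -r / (n + 1 : ℕ) * fussBinomial p (n + 1) r -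
          -((r + 1 : ℤ) : ℝ) / (n + 1 : ℕ) * fussBinomial p (n + 1) (r + 1 : ℤ) := by
      rw [hstep r, map_add, PowerSeries.coeff_succ_X_mul, ih, add_sub_cancel_left]
      cases n with
      | zero => simp [fussBinomial]
      | succ m =>
        rw [if_neg m.succ_ne_zero]
        push_cast
        have := fussBinomial_recurrence p m r
        push_cast at this
        rw [show (m : ℝ) + 1 + 1 = m + 2 by ring]
        exact this.symm
    intro r
    rw [if_neg n.succ_ne_zero]
    induction r using Int.induction_on with
    | zero => simp
    | succ i hi => linear_combination hi - hrec i
    | pred i hi =>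
      have := hrec (-i - 1)
      rw [show (-(i : ℤ) - 1 + 1) = -i by ring] at this
      linear_combination this + hi

/-- The coefficients of the powers of the inverse `v` of the Fuss–Catalan series. -/
lemma coeff_pow_fuss_inv {p : ℕ} {u v : PowerSeries ℝ} (huv : u * v = 1)
    (hu : u = 1 + PowerSeries.X * u ^ p) {n : ℕ} (hn : n ≠ 0) (r : ℕ) :
    PowerSeries.coeff n (v ^ r) = -(r / n * fussBinomial p n r) := by
  have := coeff_zpow_fuss p ⟨u, v, huv, by rw [mul_comm, huv]⟩ hu n r
  rw [if_neg hn, zpow_neg, zpow_natCast, ← inv_pow, Units.val_pow_eq_pow_val] at this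
  rw [← neg_mul, ← neg_div]
  exact_mod_cast this

open PowerSeries in
/-- The coefficients of `X u' v ^ (r + 1)`, a multiple of the derivative of `v ^ r`. -/
lemma coeff_derivative_mul_pow {p : ℕ} {u v : PowerSeries ℝ} (huv : u * v = 1)
    (hu : u = 1 + PowerSeries.X * u ^ p) {n : ℕ} (hn : n ≠ 0) {r : ℕ} (hr : r ≠ 0) :
    coeff n (X * derivative ℝ u * v ^ (r + 1)) = fussBinomial p n r := by
  have hv : derivative ℝ v = -(v ^ 2 * derivative ℝ u) := by
    have := congrArg (derivative ℝ) huv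
    rw [Derivation.leibniz, Derivation.map_one_eq_zero, smul_eq_mul, smul_eq_mul] at this
    linear_combination v * this - derivative ℝ v * huv
  have hpow : X * derivative ℝ (v ^ r) = C (-(r : ℝ)) * (X * derivative ℝ u * v ^ (r + 1)) := by
    obtain ⟨r, rfl⟩ := Nat.exists_eq_succ_of_ne_zero hr
    rw [Derivation.leibniz_pow, hv, nsmul_eq_mul, smul_eq_mul, map_neg, map_natCast,
      Nat.succ_eq_add_one, Nat.add_sub_cancel]
    ring
  obtain ⟨n, rfl⟩ := Nat.exists_eq_succ_of_ne_zero hn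
  have h := congrArg (coeff (n + 1)) hpow
  rw [coeff_succ_X_mul, coeff_derivative, coeff_pow_fuss_inv huv hu n.succ_ne_zero,
    coeff_C_mul] at h
  have hr' : (r : ℝ) ≠ 0 := by exact_mod_cast hr
  refine mul_left_cancel₀ (neg_ne_zero.2 hr') (h.symm.trans ?_)
  push_cast
  field_simp

/-! ### Marking the label `h` by a dual number -/

/-- The weight `1 + ε` for the label `h` and `1` for the other labels: the weight of a tree is
`1 + mε`, where `m` counts the labels `h`. -/
noncomputable def markWeight (h j : ℕ) : DualNumber ℝ :=
  if j = h then 1 + DualNumber.eps else 1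

lemma fst_markWeight (h j : ℕ) : (markWeight h j).fst = 1 := by
  unfold markWeight; split_ifs <;> simp

lemma snd_markWeight (h j : ℕ) : (markWeight h j).snd = if j = h then 1 else 0 := by
  unfold markWeight; split_ifs <;> simp

lemma prod_markWeight {ι : Type*} (s : Finset ι) (f : ι → ℕ) (h : ℕ) :
    (∏ v ∈ s, markWeight h (f v)).fst = 1 ∧
      (∏ v ∈ s, markWeight h (f v)).snd = ((s.filter fun v => f v = h).card : ℝ) := by
  induction s using Finset.induction_on with
  | empty => simp
  | insert a s ha ih =>
    rw [Finset.prod_insert ha, TrivSqZeroExt.fst_mul, DualNumber.snd_mul, ih.1, ih.2,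
      fst_markWeight, snd_markWeight, Finset.filter_insert]
    split_ifs with hah
    · rw [Finset.card_insert_of_notMem (by simp [ha])]
      push_cast
      exact ⟨by ring, by ring⟩
    · simp

/-- The real part of a series over the dual numbers. -/
noncomputable def fstSeries : PowerSeries (DualNumber ℝ) →+* PowerSeries ℝ :=
  PowerSeries.map (TrivSqZeroExt.fstHom ℝ ℝ ℝ).toRingHom

/-- The dual part of a series over the dual numbers. -/
noncomputable def sndSeries : PowerSeries (DualNumber ℝ) →+ PowerSeries ℝ where
  toFun f := PowerSeries.mk fun n => (PowerSeries.coeff n f).snd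
  map_zero' := by ext; simp
  map_add' f g := by ext; simp

lemma coeff_fstSeries (f : PowerSeries (DualNumber ℝ)) (n : ℕ) :
    PowerSeries.coeff n (fstSeries f) = (PowerSeries.coeff n f).fst := by
  simp [fstSeries]

lemma coeff_sndSeries (f : PowerSeries (DualNumber ℝ)) (n : ℕ) :
    PowerSeries.coeff n (sndSeries f) = (PowerSeries.coeff n f).snd := by
  simp [sndSeries]

lemma sndSeries_mul (f g : PowerSeries (DualNumber ℝ)) :
    sndSeries (f * g) = fstSeries f * sndSeries g + sndSeries f * fstSeries g := by
  ext n
  simp only [map_add, PowerSeries.coeff_mul, coeff_sndSeries, coeff_fstSeries,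
    TrivSqZeroExt.snd_sum, DualNumber.snd_mul, Finset.sum_add_distrib]

lemma sndSeries_one : sndSeries 1 = 0 := by
  ext n
  rw [coeff_sndSeries, PowerSeries.coeff_one]
  split_ifs <;> simp

lemma fstSeries_X : fstSeries PowerSeries.X = PowerSeries.X := by simp [fstSeries]

lemma sndSeries_X : sndSeries PowerSeries.X = 0 := by
  ext n
  rw [coeff_sndSeries, PowerSeries.coeff_X]
  split_ifs <;> simp

lemma fstSeries_C (a : DualNumber ℝ) : fstSeries (PowerSeries.C a) = PowerSeries.C a.fst := by
  simp [fstSeries]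

lemma sndSeries_C (a : DualNumber ℝ) : sndSeries (PowerSeries.C a) = PowerSeries.C a.snd := by
  ext n
  rw [coeff_sndSeries, PowerSeries.coeff_C, PowerSeries.coeff_C]
  split_ifs <;> simp

/-- The generating function of all `k`-noncrossing trees by the number of edges, with the label `h`
marked at all vertices, including the root. -/
noncomputable def markedSeries (k h : ℕ) : PowerSeries (DualNumber ℝ) :=
  ∑ i ∈ Finset.Icc 1 k, PowerSeries.C (markWeight h i) * treeSeries (markWeight h) k 1 i

lemma coeff_markedSeries (k h N : ℕ) : PowerSeries.coeff N (markedSeries k h) =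
    ∑ T ∈ kNoncrossingTrees k (N + 1), ∏ v, markWeight h (T.2 v) := by
  simp [markedSeries, sum_prod_kNoncrossingTrees, treeSeries]

lemma coeff_fstSeries_markedSeries (k h N : ℕ) :
    PowerSeries.coeff N (fstSeries (markedSeries k h)) =
      ((kNoncrossingTrees k (N + 1)).card : ℝ) := by
  rw [coeff_fstSeries, coeff_markedSeries, TrivSqZeroExt.fst_sum]
  simp [(prod_markWeight _ _ h).1]

lemma coeff_sndSeries_markedSeries (k h N : ℕ) :
    PowerSeries.coeff N (sndSeries (markedSeries k h)) =
      ∑ T ∈ kNoncrossingTrees k (N + 1), (labelCount h T : ℝ) := by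
  rw [coeff_sndSeries, coeff_markedSeries, TrivSqZeroExt.snd_sum]
  exact Finset.sum_congr rfl fun T _ => (prod_markWeight _ _ h).2

open PowerSeries in
/-- Both parts of the generating function in terms of the Fuss–Catalan series `u` and its
inverse `v`. -/
lemma exists_fuss_series {k h : ℕ} (hh : 1 ≤ h) (hhk : h ≤ k) :
    ∃ u v : PowerSeries ℝ, u * v = 1 ∧ u = 1 + X * u ^ (2 * k + 1) ∧
      X * fstSeries (markedSeries k h) = v ^ k - v ^ (2 * k) ∧
      X * sndSeries (markedSeries k h) = X * derivative ℝ u *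
        (C (2 * (2 * h - k - 1) : ℝ) * v ^ (2 * k + 2) +
          C (2 * (k + 2 - 2 * h) : ℝ) * v ^ (2 * k + 1) -
          C (2 * h - k - 1 : ℝ) * v ^ (k + 2) - C (k + 2 - 2 * h : ℝ) * v ^ (k + 1)) := by
  set A := treeSeries (markWeight h) k 1
  have hA (i : ℕ) (hi : 1 ≤ i) (hik : i ≤ k) : A i = 1 + X * (A i * A 1 *
      ∑ j ∈ Finset.Icc 1 (k + 1 - i), C (markWeight h j) * A j) :=
    treeSeries_one (markWeight h) hi hik
  set a : ℕ → PowerSeries ℝ := fun i => fstSeries (A i) with ha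
  set d : ℕ → PowerSeries ℝ := fun i => sndSeries (A i) with hd
  have hsumfst (n : ℕ) : fstSeries (∑ j ∈ Finset.Icc 1 n, C (markWeight h j) * A j) =
      ∑ j ∈ Finset.Icc 1 n, a j := by
    simp [map_sum, fstSeries_C, fst_markWeight, ha]
  have hsumsnd (n : ℕ) : sndSeries (∑ j ∈ Finset.Icc 1 n, C (markWeight h j) * A j) =
      (∑ j ∈ Finset.Icc 1 n, d j) + if h ≤ n then a h else 0 := by
    rw [map_sum]
    simp only [sndSeries_mul, fstSeries_C, fst_markWeight, sndSeries_C, snd_markWeight, map_one,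
      one_mul, Finset.sum_add_distrib]
    congr 1
    have (j : ℕ) : C (if j = h then (1 : ℝ) else 0) * fstSeries (A j) =
        if j = h then a j else 0 := by split_ifs <;> simp [ha]
    simp only [this, Finset.sum_ite_eq', Finset.mem_Icc, hh, true_and]
  have hfst (i : ℕ) (hi : 1 ≤ i) (hik : i ≤ k) :
      a i = 1 + X * (a i * a 1 * ∑ j ∈ Finset.Icc 1 (k + 1 - i), a j) := by
    have := congrArg fstSeries (hA i hi hik)
    simp only [map_add, map_mul, map_one, fstSeries_X, hsumfst] at this
    exact this
  have hsnd (i : ℕ) (hi : 1 ≤ i) (hik : i ≤ k) :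
      d i = X * (a i * a 1 * ((∑ j ∈ Finset.Icc 1 (k + 1 - i), d j) +
          if h ≤ k + 1 - i then a h else 0) +
        (a i * d 1 + d i * a 1) * ∑ j ∈ Finset.Icc 1 (k + 1 - i), a j) := by
    have := congrArg sndSeries (hA i hi hik)
    simp only [map_add, sndSeries_mul, sndSeries_one, sndSeries_X, map_mul, fstSeries_X, hsumfst,
      hsumsnd, zero_add, zero_mul, add_zero] at this
    exact this
  have hk := hh.trans hhk
  obtain ⟨hpow, hu⟩ := system_solution hk X a hfst
  set u := a k with hu_def
  have hu0 : constantCoeff u = 1 := by rw [hu]; simp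
  have huv : u * u⁻¹ = 1 := PowerSeries.mul_inv_cancel u (by simp [hu0])
  set v := u⁻¹ with hv
  have huvp (n : ℕ) : u ^ n * v ^ n = 1 := by rw [← mul_pow, huv, one_pow]
  have h1 : a 1 = u ^ k := by rw [hpow 1 le_rfl hk, show k + 1 - 1 = k by omega]
  -- the logarithmic derivatives, with the value `0` at `k + 1` that closes the linear system
  set e : ℕ → PowerSeries ℝ := fun i => if i ≤ k then v ^ (k + 1 - i) * d i else 0 with he
  have hde (i : ℕ) (hik : i ≤ k) : d i = u ^ (k + 1 - i) * e i := by
    simp only [he, hik, if_true]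
    linear_combination -d i * huvp (k + 1 - i)
  have hXu (j : ℕ) (hj : j ≤ k) : X * u ^ k * u ^ (k + 1 - j) = (u - 1) * v ^ j := by
    have e₁ : u ^ (2 * k + 1) = u ^ k * u ^ (k + 1 - j) * u ^ j := by
      rw [← pow_add, ← pow_add]; congr 1; omega
    rw [e₁] at hu
    linear_combination (-(X * u ^ k * u ^ (k + 1 - j))) * huvp j - v ^ j * hu
  have hlin := linear_system_solution hh hhk u v huv e (by simp [he]) ?_
  · have hd1 : d 1 = u ^ k * e 1 := by
      rw [hde 1 hk, show k + 1 - 1 = k by omega]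
    have ht := hfst 1 le_rfl hk
    have hg := hsnd 1 le_rfl hk
    rw [show k + 1 - 1 = k by omega, ← hsumfst k, h1] at ht
    rw [show k + 1 - 1 = k by omega, ← hsumsnd k, ← hsumfst k, h1, hd1] at hg
    change u ^ k = 1 + X * (u ^ k * u ^ k * fstSeries (markedSeries k h)) at ht
    change u ^ k * e 1 = X * (u ^ k * u ^ k * sndSeries (markedSeries k h) +
      (u ^ k * (u ^ k * e 1) + u ^ k * e 1 * u ^ k) * fstSeries (markedSeries k h)) at hg
    have huvk := huvp k
    have ht' : X * fstSeries (markedSeries k h) = v ^ k - v ^ (2 * k) := by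
      linear_combination -v ^ (2 * k) * ht + (v ^ k - X * fstSeries (markedSeries k h) *
        (1 + u ^ k * v ^ k)) * huvk
    have hg' : X * sndSeries (markedSeries k h) = v ^ k * e 1 * (2 * v ^ k - 1) := by
      linear_combination -v ^ (2 * k) * hg - 2 * u ^ k * u ^ k * v ^ (2 * k) * e 1 * ht' +
        (v ^ k * e 1 - (X * sndSeries (markedSeries k h) + 2 * e 1 * (v ^ k - v ^ (2 * k))) *
        (1 + u ^ k * v ^ k)) * huvk
    have hderiv : X * derivative ℝ u * (u - (2 * (k : PowerSeries ℝ) + 1) * (u - 1)) =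
        u * (u - 1) := by
      have := congrArg (derivative ℝ) hu
      rw [map_add, Derivation.map_one_eq_zero, Derivation.leibniz, Derivation.leibniz_pow,
        Nat.add_sub_cancel, nsmul_eq_mul] at this
      simp only [smul_eq_mul, derivative_X, mul_one, zero_add] at this
      push_cast at this
      linear_combination X * u * this +
        (-(2 * (k : PowerSeries ℝ) + 1) * X * derivative ℝ u - u) * hu
    have hQ : u - (2 * (k : PowerSeries ℝ) + 1) * (u - 1) ≠ 0 := by
      intro h0
      have := congrArg (constantCoeff (R := ℝ)) h0
      simp [hu0] at this
    have he1 : e 1 * u ^ 2 = X * derivative ℝ u *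
        (1 + ((k : PowerSeries ℝ) + 2 - 2 * (h : PowerSeries ℝ)) * (u - 1)) := by
      refine mul_left_cancel₀ hQ ?_
      linear_combination u * hlin -
        (1 + ((k : PowerSeries ℝ) + 2 - 2 * (h : PowerSeries ℝ)) * (u - 1)) * hderiv
    refine ⟨u, v, huv, hu, ht', hg'.trans ?_⟩
    simp only [map_mul, map_sub, map_add, map_natCast, map_ofNat, map_one]
    have he1' : e 1 = v ^ 2 * (X * derivative ℝ u *
        (1 + ((k : PowerSeries ℝ) + 2 - 2 * (h : PowerSeries ℝ)) * (u - 1))) := by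
      linear_combination v ^ 2 * he1 - e 1 * (1 + u * v) * huv
    rw [he1']
    linear_combination X * derivative ℝ u * ((k : PowerSeries ℝ) + 2 - 2 * (h : PowerSeries ℝ)) *
      (2 * v ^ (2 * k + 1) - v ^ (k + 1)) * huv
  · intro n hn
    rcases Nat.eq_zero_or_pos n with rfl | hn0
    · simp [he, show ¬ h ≤ 0 by omega]
    have hs2 := hsnd (k + 1 - n) (by omega) (by omega)
    have hf := hfst (k + 1 - n) (by omega) (by omega)
    rw [hde _ (by omega : k + 1 - n ≤ k), hde 1 hk] at hs2
    rw [hpow (k + 1 - n) (by omega) (by omega)] at hs2 hf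
    rw [show k + 1 - (k + 1 - n) = n by omega, h1] at hs2 hf
    rw [show k + 1 - 1 = k by omega] at hs2
    have hUV := huvp n
    have hs : X * u ^ k * ∑ j ∈ Finset.Icc 1 n, a j = 1 - v ^ n := by
      linear_combination -v ^ n * hf + (1 - X * u ^ k * ∑ j ∈ Finset.Icc 1 n, a j) * hUV
    have hG : X * u ^ k * ((∑ j ∈ Finset.Icc 1 n, d j) + if h ≤ n then a h else 0) =
        (u - 1) * ((∑ j ∈ Finset.Icc 1 n, v ^ j * e j) + if h ≤ n then v ^ h else 0) := by
      rw [mul_add, mul_add, Finset.mul_sum, Finset.mul_sum]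
      congr 1
      · refine Finset.sum_congr rfl fun j hj => ?_
        rw [Finset.mem_Icc] at hj
        rw [hde j (by omega)]
        linear_combination e j * hXu j (by omega)
      · split_ifs
        · rw [hpow h hh hhk, hXu h hhk]
        · simp
    linear_combination v ^ n * hs2 + u ^ n * v ^ n * hG +
      u ^ n * v ^ n * (e 1 + e (k + 1 - n)) * hs -
      (e (k + 1 - n) - (u - 1) * ((∑ j ∈ Finset.Icc 1 n, v ^ j * e j) +
        if h ≤ n then v ^ h else 0) - (1 - v ^ n) * (e 1 + e (k + 1 - n))) * hUV

/-! ### The exact average -/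

lemma fussBinomial_succ (p n : ℕ) (hn : 1 ≤ n) (r : ℝ) :
    fussBinomial p n (r + 1) * (n * p - r - 1) = fussBinomial p n r * (n * p - r - n) := by
  obtain ⟨m, rfl⟩ : ∃ m, n = m + 1 := ⟨n - 1, by omega⟩
  have h₁ := Finset.prod_range_succ (fun j : ℕ => ((m + 1 : ℕ) : ℝ) * p - r - 1 - j) m
  have h₂ := Finset.prod_range_succ' (fun j : ℕ => ((m + 1 : ℕ) : ℝ) * p - r - 1 - j) m
  have h₃ : ∏ j ∈ Finset.range m, (((m + 1 : ℕ) : ℝ) * p - r - 1 - ((j + 1 : ℕ) : ℝ)) =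
      ∏ j ∈ Finset.range m, (((m + 1 : ℕ) : ℝ) * p - (r + 1) - 1 - j) :=
    Finset.prod_congr rfl fun j _ => by push_cast; ring
  rw [h₃] at h₂
  have h := h₂.symm.trans h₁
  rw [fussBinomial, fussBinomial, Nat.add_sub_cancel, div_mul_eq_mul_div, div_mul_eq_mul_div]
  congr 1
  push_cast at h ⊢
  linear_combination h

/-- The quotient of rising factorials in the average, the quotient of the two binomial coefficients
that occur in the number of trees. -/
noncomputable def risingRatio (k n : ℕ) : ℝ :=
  risingFactorial (2 * k * n + n - 2 * k) k / risingFactorial (2 * k * n + 1 - 2 * k) k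

section
variable {k n : ℕ}

lemma denominator_pos (hn : 1 ≤ n) (i : ℕ) : 0 < 2 * (k : ℝ) * n + 1 - 2 * k + i := by
  have : (1 : ℝ) ≤ n := by exact_mod_cast hn
  have h₁ : 0 ≤ 2 * (k : ℝ) * (n - 1) := mul_nonneg (by positivity) (by linarith)
  have h₂ : (0 : ℝ) ≤ i := by positivity
  linarith

lemma risingFactorial_pos (hn : 1 ≤ n) : 0 < risingFactorial (2 * k * n + 1 - 2 * k) k :=
  Finset.prod_pos fun i _ => denominator_pos hn i

lemma risingRatio_eq_prod : risingRatio k n = ∏ i ∈ Finset.range k,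
    ((2 * k * n + n - 2 * k + i) / (2 * k * n + 1 - 2 * k + i) : ℝ) := by
  rw [risingRatio, risingFactorial, risingFactorial, Finset.prod_div_distrib]

lemma fussBinomial_ratio (hn : 1 ≤ n) :
    fussBinomial (2 * k + 1) n k = fussBinomial (2 * k + 1) n (2 * k) * risingRatio k n := by
  have key (t : ℕ) : fussBinomial (2 * k + 1) n (2 * k - t) *
      ∏ i ∈ Finset.range t, (2 * k * n + 1 - 2 * k + i : ℝ) =
      fussBinomial (2 * k + 1) n (2 * k) *
        ∏ i ∈ Finset.range t, (2 * k * n + n - 2 * k + i : ℝ) := by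
    induction t with
    | zero => simp
    | succ t ih =>
      have h := fussBinomial_succ (2 * k + 1) n hn (2 * k - t - 1)
      rw [show (2 * k - t - 1 : ℝ) + 1 = 2 * k - t by ring] at h
      rw [Finset.prod_range_succ, Finset.prod_range_succ,
        show (2 * k - (t + 1 : ℕ) : ℝ) = 2 * k - t - 1 by push_cast; ring]
      push_cast at h
      linear_combination (2 * k * n + n - 2 * k + t : ℝ) * ih -
        (∏ i ∈ Finset.range t, (2 * k * n + 1 - 2 * k + i : ℝ)) * h
  have h := key k
  rw [show (2 * k - k : ℝ) = k by ring] at h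
  rw [risingRatio, ← mul_div_assoc, eq_div_iff (risingFactorial_pos hn).ne']
  exact h

lemma fussBinomial_pos (hn : 1 < n) : 0 < fussBinomial (2 * k + 1) n (2 * k) := by
  refine div_pos (Finset.prod_pos fun j hj => ?_) (by positivity)
  rw [Finset.mem_range] at hj
  have h₁ : (j : ℝ) + 1 + 1 ≤ n := by exact_mod_cast (by omega : j + 1 + 1 ≤ n)
  have h₂ : 0 ≤ (k : ℝ) * (n - 1) := mul_nonneg (by positivity) (by
    have : (0 : ℝ) ≤ j := by positivity
    linarith)
  push_cast
  linarith

lemma half_lt_pow : 1 / 2 < (2 * (k : ℝ) / (2 * k + 1)) ^ k := by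
  have hk : (0 : ℝ) ≤ k := by positivity
  have h := one_add_mul_le_pow (a := -1 / (2 * (k : ℝ) + 1)) (by
    rw [le_div_iff₀ (by positivity)]; linarith) k
  rw [show 1 + -1 / (2 * (k : ℝ) + 1) = 2 * k / (2 * k + 1) by field_simp; ring] at h
  refine lt_of_lt_of_le ?_ h
  rw [← sub_pos, show 1 + (k : ℝ) * (-1 / (2 * k + 1)) - 1 / 2 = 1 / (2 * (2 * k + 1)) by
    field_simp; ring]
  positivity

lemma inv_pow_lt_two (hk : 1 ≤ k) : ((2 * (k : ℝ) + 1) / (2 * k)) ^ k < 2 := by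
  have h := half_lt_pow (k := k)
  have hk' : (0 : ℝ) < k := by exact_mod_cast hk
  rw [← inv_div, inv_pow]
  exact inv_lt_of_inv_lt₀ (by norm_num) (by simpa using h)

/-- Each factor of the quotient is at most `1 + 1 / (2k)`, and the `k`-th power of that is less
than `2`. -/
lemma risingRatio_lt_two (hk : 1 ≤ k) (hn : 1 ≤ n) : risingRatio k n < 2 := by
  refine lt_of_le_of_lt ?_ (inv_pow_lt_two hk)
  have hk' : (0 : ℝ) < k := by exact_mod_cast hk
  have hn' : (1 : ℝ) ≤ n := by exact_mod_cast hn
  rw [risingRatio_eq_prod]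
  refine (Finset.prod_le_prod (g := fun _ => (2 * (k : ℝ) + 1) / (2 * k)) (fun i _ => ?_)
    fun i _ => ?_).trans_eq (by rw [Finset.prod_const, Finset.card_range])
  · refine (div_pos ?_ (denominator_pos hn i)).le
    have := denominator_pos (k := k) hn i
    linarith
  rw [div_le_div_iff₀ (denominator_pos hn i) (by positivity)]
  have : (0 : ℝ) ≤ i := by positivity
  linarith

lemma card_eq (hk : 1 ≤ k) (hn : 1 < n) : ((kNoncrossingTrees k n).card : ℝ) =
    k / n * fussBinomial (2 * k + 1) n (2 * k) * (2 - risingRatio k n) := by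
  obtain ⟨N, rfl⟩ : ∃ N, n = N + 1 := ⟨n - 1, by omega⟩
  obtain ⟨u, v, huv, hu, h₁, -⟩ := exists_fuss_series le_rfl hk
  have h := congrArg (PowerSeries.coeff (N + 1)) h₁
  rw [PowerSeries.coeff_succ_X_mul, coeff_fstSeries_markedSeries, map_sub,
    coeff_pow_fuss_inv huv hu N.succ_ne_zero, coeff_pow_fuss_inv huv hu N.succ_ne_zero,
    fussBinomial_ratio hn.le] at h
  rw [h]
  push_cast
  ring

lemma sum_labelCount_eq {h : ℕ} (hh : 1 ≤ h) (hhk : h ≤ k) (hn : 1 < n) :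
    ∑ T ∈ kNoncrossingTrees k n, (labelCount h T : ℝ) =
      2 * (2 * h - k - 1) * fussBinomial (2 * k + 1) n (2 * k + 1) +
        2 * (k + 2 - 2 * h) * fussBinomial (2 * k + 1) n (2 * k) -
        (2 * h - k - 1) * fussBinomial (2 * k + 1) n (k + 1) -
        (k + 2 - 2 * h) * fussBinomial (2 * k + 1) n k := by
  obtain ⟨N, rfl⟩ : ∃ N, n = N + 1 := ⟨n - 1, by omega⟩
  obtain ⟨u, v, huv, hu, -, h₂⟩ := exists_fuss_series hh hhk
  have hcoeff (a : ℝ) (r : ℕ) (hr : r ≠ 0) : PowerSeries.coeff (N + 1)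
      (PowerSeries.X * PowerSeries.derivative ℝ u * (PowerSeries.C a * v ^ (r + 1))) =
      a * fussBinomial (2 * k + 1) (N + 1) r := by
    rw [mul_left_comm, PowerSeries.coeff_C_mul,
      coeff_derivative_mul_pow huv hu N.succ_ne_zero hr]
  have h := congrArg (PowerSeries.coeff (N + 1)) h₂
  rw [PowerSeries.coeff_succ_X_mul, coeff_sndSeries_markedSeries] at h
  rw [h, mul_sub, mul_sub, mul_add, map_sub, map_sub, map_add, hcoeff _ (2 * k + 1) (by omega),
    hcoeff _ (2 * k) (by omega), hcoeff _ (k + 1) (by omega), hcoeff _ k (by omega)]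
  push_cast
  ring

lemma linear_denominator_pos (hn : 1 < n) : 0 < (2 * (k : ℝ) + 1) * n - (k + 1) := by
  have h₁ : (2 : ℝ) ≤ n := by exact_mod_cast hn
  have h₂ : 0 ≤ (2 * (k : ℝ) + 1) * (n - 2) := mul_nonneg (by positivity) (by linarith)
  have h₃ : (0 : ℝ) ≤ k := by positivity
  linarith

lemma average_eq {h : ℕ} (hh : 1 ≤ h) (hhk : h ≤ k) (hn : 1 < n) : averageLabelCount k n h =
    (n : ℝ) / ((2 * k + 1) * n - (k + 1)) * (3 * n - 2 - 2 * ((h : ℝ) - 1) * ((n : ℝ) - 1) / k +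
      2 * ((k : ℝ) + 1 - 2 * h) / ((2 * k + 1) * (2 - risingRatio k n))) := by
  have hk : 1 ≤ k := hh.trans hhk
  have hk' : (k : ℝ) ≠ 0 := by positivity
  have hn' : (n : ℝ) ≠ 0 := by positivity
  have hn1 : (n : ℝ) - 1 ≠ 0 := by
    have : (1 : ℝ) < n := by exact_mod_cast hn
    linarith
  have hD := (linear_denominator_pos (k := k) hn).ne'
  have hp : 2 * (k : ℝ) + 1 ≠ 0 := by positivity
  have hB := (fussBinomial_pos (k := k) hn).ne'
  have hρ : 2 - risingRatio k n ≠ 0 := (sub_pos.2 (risingRatio_lt_two hk hn.le)).ne'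
  have e₁ : fussBinomial (2 * k + 1) n (2 * k + 1) =
      fussBinomial (2 * k + 1) n (2 * k) * (2 * k / (2 * k + 1)) := by
    have := fussBinomial_succ (2 * k + 1) n hn.le (2 * k)
    push_cast at this
    rw [← mul_div_assoc, eq_div_iff hp]
    refine mul_right_cancel₀ hn1 ?_
    linear_combination this
  have e₂ : fussBinomial (2 * k + 1) n (k + 1) = fussBinomial (2 * k + 1) n (2 * k) *
      risingRatio k n * ((2 * k * n - k) / ((2 * k + 1) * n - (k + 1))) := by
    have := fussBinomial_succ (2 * k + 1) n hn.le k
    rw [fussBinomial_ratio hn.le] at this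
    push_cast at this
    rw [← mul_div_assoc, eq_div_iff hD]
    linear_combination this
  rw [averageLabelCount, card_eq hk hn, sum_labelCount_eq hh hhk hn, e₁, e₂,
    fussBinomial_ratio hn.le]
  generalize fussBinomial (2 * k + 1) n (2 * k) = B at *
  generalize risingRatio k n = ρ at *
  field_simp
  ring

end

/-! ### The asymptotic expansion -/

section asymptotics
variable {f g : ℕ → ℝ} {a b : ℝ}

lemma tendsto_of_sub_isBigO (hf : (fun n => f n - a) =O[atTop] (fun n : ℕ => 1 / (n : ℝ))) :
    Tendsto f atTop (nhds a) := by
  have h := (hf.trans_tendsto tendsto_one_div_atTop_nhds_zero_nat).add_const a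
  simpa using h

lemma mul_sub_isBigO (hf : (fun n => f n - a) =O[atTop] (fun n : ℕ => 1 / (n : ℝ)))
    (hg : (fun n => g n - b) =O[atTop] (fun n : ℕ => 1 / (n : ℝ))) :
    (fun n => f n * g n - a * b) =O[atTop] (fun n : ℕ => 1 / (n : ℝ)) := by
  have h₁ := hf.mul ((tendsto_of_sub_isBigO hg).isBigO_one ℝ)
  have h₂ := hg.const_mul_left a
  simp only [mul_one] at h₁
  exact (h₁.add h₂).congr_left fun n => by ring

lemma inv_sub_isBigO (hf : (fun n => f n - a) =O[atTop] (fun n : ℕ => 1 / (n : ℝ)))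
    (ha : a ≠ 0) : (fun n => (f n)⁻¹ - a⁻¹) =O[atTop] (fun n : ℕ => 1 / (n : ℝ)) := by
  have hlim := tendsto_of_sub_isBigO hf
  have h₁ := (hf.const_mul_left (-a⁻¹)).mul ((hlim.inv₀ ha).isBigO_one ℝ)
  simp only [mul_one] at h₁
  refine h₁.congr' ?_ .rfl
  filter_upwards [hlim.eventually_ne ha] with n hn
  field_simp
  ring

lemma affine_div_sub_isBigO (a b : ℝ) :
    (fun n : ℕ => (a * n + b) / n - a) =O[atTop] (fun n : ℕ => 1 / (n : ℝ)) := by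
  refine ((isBigO_refl (fun n : ℕ => 1 / (n : ℝ)) atTop).const_mul_left b).congr' ?_ .rfl
  filter_upwards [eventually_ne_atTop 0] with n hn
  field_simp
  ring

lemma affine_div_affine_sub_isBigO (a b c d : ℝ) (hc : c ≠ 0) :
    (fun n : ℕ => (a * n + b) / (c * n + d) - a / c) =O[atTop] (fun n : ℕ => 1 / (n : ℝ)) := by
  have h := mul_sub_isBigO (affine_div_sub_isBigO a b)
    (inv_sub_isBigO (affine_div_sub_isBigO c d) hc)
  refine h.congr' ?_ .rfl
  filter_upwards [eventually_ne_atTop 0] with n hn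
  have hn' : (n : ℝ) ≠ 0 := by exact_mod_cast hn
  rw [inv_div, div_mul_div_cancel₀ hn', div_eq_mul_inv a c]

lemma prod_sub_isBigO {F : ℕ → ℕ → ℝ}
    (hF : ∀ i, (fun n => F i n - a) =O[atTop] (fun n : ℕ => 1 / (n : ℝ))) (m : ℕ) :
    (fun n => (∏ i ∈ Finset.range m, F i n) - a ^ m) =O[atTop] (fun n : ℕ => 1 / (n : ℝ)) := by
  induction m with
  | zero => simpa using isBigO_zero _ _
  | succ m ih =>
    simp only [Finset.prod_range_succ, pow_succ]
    exact mul_sub_isBigO ih (hF m)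

end asymptotics

lemma risingRatio_sub_isBigO {k : ℕ} (hk : 1 ≤ k) :
    (fun n => risingRatio k n - ((2 * (k : ℝ) + 1) / (2 * k)) ^ k) =O[atTop]
      (fun n : ℕ => 1 / (n : ℝ)) := by
  simp only [risingRatio_eq_prod]
  refine prod_sub_isBigO (F := fun i n =>
    (2 * k * n + n - 2 * k + i) / (2 * k * n + 1 - 2 * k + i)) (fun i => ?_) k
  refine (affine_div_affine_sub_isBigO (2 * k + 1) (i - 2 * k) (2 * k) (1 - 2 * k + i)
    (by positivity)).congr_left fun n => ?_
  congr 2 <;> ring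

theorem mainTheorem8 (k h : ℕ) (hh : 1 ≤ h) (hhk : h ≤ k) :
    (∀ n : ℕ, 1 < n →
      (kNoncrossingTrees k n).Nonempty ∧
      (2 * (k : ℝ) + 1) * n - (k + 1) ≠ 0 ∧
      risingFactorial (2 * k * n + 1 - 2 * k) k ≠ 0 ∧
      2 - risingFactorial (2 * k * n + n - 2 * k) k /
          risingFactorial (2 * k * n + 1 - 2 * k) k ≠ 0 ∧
      averageLabelCount k n h =
        (n : ℝ) / ((2 * k + 1) * n - (k + 1)) *
          (3 * n - 2 - 2 * ((h : ℝ) - 1) * ((n : ℝ) - 1) / k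
            + 2 * ((k : ℝ) + 1 - 2 * h) /
              ((2 * k + 1) *
                (2 - risingFactorial (2 * k * n + n - 2 * k) k /
                  risingFactorial (2 * k * n + 1 - 2 * k) k)))) ∧
    2 * (2 * (k : ℝ) / (2 * k + 1)) ^ k - 1 ≠ 0 ∧
    (fun n : ℕ => averageLabelCount k n h -
        ((3 * (k : ℝ) + 2 - 2 * h) / (k * (2 * k + 1)) * n
          + ((k : ℝ) + 1 - 2 * h) /
            ((2 * k + 1) ^ 2 * (2 * (2 * (k : ℝ) / (2 * k + 1)) ^ k - 1))))
      =O[atTop] (fun n : ℕ => 1 / (n : ℝ)) := by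
  have hk : 1 ≤ k := hh.trans hhk
  have hk' : (k : ℝ) ≠ 0 := by positivity
  have hp : 2 * (k : ℝ) + 1 ≠ 0 := by positivity
  have hσ := half_lt_pow (k := k)
  refine ⟨fun n hn => ⟨?_, (linear_denominator_pos hn).ne', (risingFactorial_pos hn.le).ne',
    (sub_pos.2 (risingRatio_lt_two hk hn.le)).ne', average_eq hh hhk hn⟩, by linarith, ?_⟩
  · rw [← Finset.card_pos, ← Nat.cast_pos (α := ℝ), card_eq hk hn]
    have := risingRatio_lt_two hk hn.le
    have := fussBinomial_pos (k := k) hn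
    have : 0 < 2 - risingRatio k n := by linarith
    positivity
  set σ := (2 * (k : ℝ) / (2 * k + 1)) ^ k with hσ_def
  have hρ : ((2 * (k : ℝ) + 1) / (2 * k)) ^ k = σ⁻¹ := by rw [hσ_def, ← inv_pow, inv_div]
  have hσ0 : σ ≠ 0 := by linarith
  have hσ1 : 2 * σ - 1 ≠ 0 := by linarith
  have h2 : 2 - σ⁻¹ ≠ 0 := by
    rw [← hρ]; exact (sub_pos.2 (inv_pow_lt_two hk)).ne'
  have h₁ : (fun n => (2 - risingRatio k n) - (2 - σ⁻¹)) =O[atTop] (fun n : ℕ => 1 / (n : ℝ)) := by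
    have := (risingRatio_sub_isBigO hk).neg_left
    rw [hρ] at this
    exact this.congr_left fun n => by ring
  -- the average is `A n / p + (n / (p n - q)) (A q / p + B + C / (2 - ρ))` with
  -- `A = 3 - 2 (h - 1) / k`, `B = 2 (h - 1) / k - 2`, `C = 2 (k + 1 - 2 h) / p`, `p = 2 k + 1` and
  -- `q = k + 1`
  have h₂ := affine_div_affine_sub_isBigO 1 0 (2 * k + 1) (-(k + 1)) hp
  have h₃ := (inv_sub_isBigO h₁ h2).const_mul_left (2 * ((k : ℝ) + 1 - 2 * h) / (2 * k + 1))
  set D : ℝ := (3 - 2 * ((h : ℝ) - 1) / k) * (k + 1) / (2 * k + 1) + (2 * (h - 1) / k - 2) with hD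
  have h₄ : (fun n => (D + 2 * ((k : ℝ) + 1 - 2 * h) / (2 * k + 1) * (2 - risingRatio k n)⁻¹) -
      (D + 2 * ((k : ℝ) + 1 - 2 * h) / (2 * k + 1) * (2 - σ⁻¹)⁻¹)) =O[atTop]
      (fun n : ℕ => 1 / (n : ℝ)) := h₃.congr_left fun n => by ring
  refine (mul_sub_isBigO h₂ h₄).congr' ?_ .rfl
  filter_upwards [eventually_gt_atTop 1] with n hn
  rw [average_eq hh hhk hn]
  have hd := (linear_denominator_pos (k := k) hn).ne'
  have hr : 2 - risingRatio k n ≠ 0 := (sub_pos.2 (risingRatio_lt_two hk hn.le)).ne'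
  have hd' : (2 * (k : ℝ) + 1) * n + -(k + 1) ≠ 0 := by rwa [← sub_eq_add_neg]
  have hinv : (2 - σ⁻¹)⁻¹ = σ / (2 * σ - 1) := by
    rw [inv_eq_iff_eq_inv, inv_div]; field_simp
  rw [hinv, hD]
  generalize risingRatio k n = ρ at *
  have e₁ : (1 * (n : ℝ) + 0) / ((2 * k + 1) * n + -(k + 1)) * (((3 - 2 * ((h : ℝ) - 1) / k) *
      (k + 1) / (2 * k + 1) + (2 * (h - 1) / k - 2)) +
      2 * ((k : ℝ) + 1 - 2 * h) / (2 * k + 1) * (2 - ρ)⁻¹) =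
      (n : ℝ) / ((2 * k + 1) * n - (k + 1)) * (3 * n - 2 - 2 * ((h : ℝ) - 1) * ((n : ℝ) - 1) / k +
      2 * ((k : ℝ) + 1 - 2 * h) / ((2 * k + 1) * (2 - ρ))) -
      (3 * (k : ℝ) + 2 - 2 * h) / (k * (2 * k + 1)) * n := by
    rw [← sub_eq_add_neg, div_mul_eq_mul_div (1 * (n : ℝ) + 0), div_mul_eq_mul_div (n : ℝ),
      div_sub' hd, div_left_inj' hd]
    field_simp
    ring
  have e₂ : 1 / (2 * (k : ℝ) + 1) * (((3 - 2 * ((h : ℝ) - 1) / k) *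
      (k + 1) / (2 * k + 1) + (2 * (h - 1) / k - 2)) +
      2 * ((k : ℝ) + 1 - 2 * h) / (2 * k + 1) * (σ / (2 * σ - 1))) =
      ((k : ℝ) + 1 - 2 * h) / ((2 * k + 1) ^ 2 * (2 * σ - 1)) := by
    clear_value σ
    field_simp
    ring
  rw [e₁, e₂]
  ring
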